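/- **Setting.** All manifolds are smooth and without boundary. Null hypersurface data $\{\mathcal N,\gamma,\boldsymbol\ell,\ell^{(2)},\mathbf Y\}$ consist of an $\mathfrak n$-dimensional manifold $\mathcal N$, a symmetric $(0,2)$-tensor $\gamma$ of signature $(0,+,\dots,+)$, a covector $\boldsymbol\ell$, a scalar $\ell^{(2)}$ and a symmetric $(0,2)$-tensor $\mathbf Y$, such that the form $\mathcal A((W,a),(Z,b))=\gamma(W,Z)+a\,\boldsymbol\ell(Z)+b\,\boldsymbol\ell(W)+ab\,\ell^{(2)}$ on $T_p\mathcal N\times\mathbb R$ is non-degenerate at every $p\in\mathcal N$. Its inverse splits as $P(\theta,\theta')+a\,\theta'(n)+b\,\theta(n)$ on $((\theta,a),(\theta',b))$, which defines a symmetric $(2,0)$-tensor $P$ and a vector field $n$. Put $\mathbf F=\tfrac12 d\boldsymbol\ell$, $\mathbf s=\mathbf F(n,\cdot)$, $\mathbf U=\tfrac12\pounds_n\gamma$, $\mathbf r=\mathbf Y(n,\cdot)$, and let $\overset{\circ}{\nabla}$ be the unique torsion-free connection with $\overset{\circ}{\nabla}_a\gamma_{bc}=-\ell_bU_{ac}-\ell_cU_{ab}$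 and $\overset{\circ}{\nabla}_a\ell_b=F_{ab}-\ell^{(2)}U_{ab}$. The data are $\{\phi,\zeta\}$-embedded in an $(\mathfrak n+1)$-dimensional Lorentzian manifold $(\mathcal M,g)$ of signature $(-,+,\dots,+)$ if $\phi:\mathcal N\to\mathcal M$ is an embedding and $\zeta$ is a vector field along $\phi(\mathcal N)$, everywhere transverse to it, with $\phi^\star g=\gamma$, $\phi^\star(g(\zeta,\cdot))=\boldsymbol\ell$, $\phi^\star(g(\zeta,\zeta))=\ell^{(2)}$ and $\tfrac12\phi^\star(\pounds_\zeta g)=\mathbf Y$. Let $\nu$ be the vector field along $\phi(\mathcal N)$ that is $g$-orthogonal to $\phi(\mathcal N)$ and satisfies $g(\nu,\zeta)=1$. **Lemma.** Let null hypersurface data be $\{\phi,\zeta\}$-embedded in $(\mathcal M,g)$, let $\nabla$ be the Levi-Civita connection of $g$, and let $\eta$ be a smooth vector field on a neighbourhood of $\phi(\mathcal N)$ that is null and tangent to $\phi(\mathcal N)$ at $\phi(\mathcal N)$. Define $\alpha$ on $\mathcal N$ by $\eta|_{\phi(\mathcal N)}=\alpha\,\phi_\star n$. Let $\Sigma=\pounds_\eta\nabla$,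 i.e. $\Sigma(X,W)=\pounds_\eta\nabla_XW-\nabla_X\pounds_\eta W-\nabla_{\pounds_\eta X}W$, let $\mathcal K=\pounds_\eta g$, and put $$\mathfrak p=\phi^\star(\mathcal K(\zeta,\zeta)),\quad \mathfrak w=\phi^\star(\mathcal K(\zeta,\nu)),\quad \mathfrak q=\phi^\star(\mathcal K(\zeta,\cdot)),\quad \mathfrak I=\tfrac12\phi^\star(\pounds_\zeta\mathcal K).$$ Let $\{\hat e_a\}$ be any local basis of vector fields on $\mathcal N$, $e_a=\phi_\star\hat e_a$. Then $$\begin{aligned}\Sigma(e_a,e_b)={}&\Big((\mathfrak w-n(\alpha))U_{ab}-\alpha(\pounds_n\mathbf U)_{ab}\Big)\zeta\\ &+\Big(\overset{\circ}{\nabla}_a\overset{\circ}{\nabla}_b\alpha+2(\overset{\circ}{\nabla}_{(a}\alpha)(s_{b)}-r_{b)})+2\alpha\overset{\circ}{\nabla}_{(a}s_{b)}+n(\alpha)Y_{ab}-\alpha(\pounds_n\mathbf Y)_{ab}+\tfrac12\big(\alpha\,n(\ell^{(2)})+\mathfrak p\big)U_{ab}\Big)\nu\\ &+P^{cd}\Big(2(\overset{\circ}{\nabla}_{(a}\alpha)U_{b)c}+U_{ab}(\mathfrak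 q_c-\overset{\circ}{\nabla}_c\alpha)+\alpha(\overset{\circ}{\nabla}_aU_{bc}+\overset{\circ}{\nabla}_bU_{ca}-\overset{\circ}{\nabla}_cU_{ab})\Big)e_d.\end{aligned}$$ In particular, if $\mathbf U=0$, then $$\Sigma(e_a,e_b)=\Big(\overset{\circ}{\nabla}_a\overset{\circ}{\nabla}_b\alpha+2(\overset{\circ}{\nabla}_{(a}\alpha)(s_{b)}-r_{b)})+2\alpha\overset{\circ}{\nabla}_{(a}s_{b)}+n(\alpha)Y_{ab}-\alpha(\pounds_n\mathbf Y)_{ab}\Big)\nu,$$ and equivalently $\Sigma(e_a,e_b)=\mathfrak B_{ab}\,\nu$, where $\mathfrak B_{ab}=\overset{\circ}{\nabla}_{(a}\mathfrak q_{b)}+\mathfrak w Y_{ab}+\mathfrak p U_{ab}-\mathfrak I_{ab}$. -/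

import Mathlib

open scoped Manifold ContDiff Topology
open Bundle

noncomputable section

namespace NullHyp

/-! ### Calculus on a smooth manifold, in terms of vector fields

A covariant tensor field of rank one or two is handled as the operator that sends vector fields to
functions. All the operators below are tensorial or first-order differential in the vector fields,
exactly as in the usual invariant definitions. -/

section Calculus

variable {E : Type*} [NormedAddCommGroup E] [NormedSpace ℝ E]
  {H : Type*} [TopologicalSpace H] (I : ModelWithCorners ℝ E H)
  (M : Type*) [TopologicalSpace M] [ChartedSpace H M] [IsManifold I ∞ M]

/-- (Not necessarily smooth) vector fields. -/
abbrev VF := ∀ x : M, TangentSpace I x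

/-- Covariant rank-one tensors, as operators on vector fields. -/
abbrev Cov1 := VF I M → M → ℝ

/-- Covariant rank-two tensors, as operators on vector fields. -/
abbrev Cov2 := VF I M → VF I M → M → ℝ

variable {I M}

/-- The vector field `X` is `C^∞` at `x`. -/
def SmoothAt (X : VF I M) (x : M) : Prop :=
  ContMDiffAt I I.tangent ∞ (fun y => (⟨y, X y⟩ : TangentBundle I M)) x

/-- The vector field `X` is differentiable at `x`. -/
def DiffAt (X : VF I M) (x : M) : Prop :=
  MDifferentiableAt I I.tangent (fun y => (⟨y, X y⟩ : TangentBundle I M)) x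

/-- `X(f)`, the derivative of the function `f` along the vector field `X`. -/
def dir (X : VF I M) (f : M → ℝ) : M → ℝ := fun x => mvfderiv I f x (X x)

/-- The differential of a function: `(df)(X) = X(f)`. -/
def dOp (f : M → ℝ) : Cov1 I M := fun X => dir X f

/-- A field of linear forms as an operator on vector fields. -/
def op1 (θ : ∀ x : M, TangentSpace I x →L[ℝ] ℝ) : Cov1 I M := fun X x => θ x (X x)

/-- A field of bilinear forms as an operator on vector fields. -/
def op2 (T : ∀ x : M, TangentSpace I x →L[ℝ] TangentSpace I x →L[ℝ] ℝ) : Cov2 I M :=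
  fun X Y x => T x (X x) (Y x)

/-- Lie derivative of a covariant rank-two tensor:
`(£_X T)(Y, Z) = X(T(Y, Z)) - T([X, Y], Z) - T(Y, [X, Z])`. -/
def lie2 (X : VF I M) (T : Cov2 I M) : Cov2 I M := fun Y Z x =>
  dir X (T Y Z) x - T (VectorField.mlieBracket I X Y) Z x - T Y (VectorField.mlieBracket I X Z) x

/-- Exterior derivative of a one-form: `(dθ)(X, Y) = X(θ(Y)) - Y(θ(X)) - θ([X, Y])`. -/
def ext1 (θ : Cov1 I M) : Cov2 I M := fun X Y x =>
  dir X (θ Y) x - dir Y (θ X) x - θ (VectorField.mlieBracket I X Y) x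

/-- The value at the tangent vectors `v, w` at `x` of a tensorial operator. The vectors are extended
to vector fields that are smooth near `x` (with constant components in a chart); by tensoriality
the result does not depend on the extension. -/
def at2 {A : M → Type*} (T : VF I M → VF I M → ∀ x, A x) (x : M) (v w : TangentSpace I x) : A x :=
  T (FiberBundle.extend E v) (FiberBundle.extend E w) x

/-- `∇_X W`. -/
def cov (D : CovariantDerivative I E (TangentSpace I : M → Type _)) (X W : VF I M) : VF I M :=
  fun x => D W x (X x)

/-- `(∇_X θ)(Y) = X(θ(Y)) - θ(∇_X Y)`. -/
def cov1 (D : CovariantDerivative I E (TangentSpace I : M → Type _)) (θ : Cov1 I M)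
    (X Y : VF I M) : M → ℝ := fun x =>
  dir X (θ Y) x - θ (cov D X Y) x

/-- `(∇_X T)(Y, Z) = X(T(Y, Z)) - T(∇_X Y, Z) - T(Y, ∇_X Z)`. -/
def cov2 (D : CovariantDerivative I E (TangentSpace I : M → Type _)) (T : Cov2 I M)
    (X Y Z : VF I M) : M → ℝ := fun x =>
  dir X (T Y Z) x - T (cov D X Y) Z x - T Y (cov D X Z) x

/-- Lie derivative of a connection along `η`:
`(£_η ∇)(X, W) = £_η(∇_X W) - ∇_X(£_η W) - ∇_{£_η X} W`. -/
def lieConn (D : CovariantDerivative I E (TangentSpace I : M → Type _)) (η X W : VF I M) :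
    VF I M := fun x =>
  VectorField.mlieBracket I η (cov D X W) x - cov D X (VectorField.mlieBracket I η W) x
    - cov D (VectorField.mlieBracket I η X) W x

/-- A connection on the tangent bundle is smooth: on every open set it maps smooth vector fields to
smooth sections of `Hom(TM, TM)`. -/
def SmoothConn
    (D : CovariantDerivative I E (TangentSpace I : M → Type _)) : Prop :=
  ∀ u : Set M, IsOpen u → ContMDiffCovariantDerivativeOn E ∞ D.toFun u

end Calculus

/-! ### Spacetimes -/

/-- The model vector space of `k`-dimensional manifolds. -/
abbrev E (k : ℕ) := EuclideanSpace ℝ (Fin k)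

/-- A smooth metric of signature `(-, +, ..., +)` on a manifold of dimension `d + 1`. -/
structure LorentzianMetric (d : ℕ) (M : Type*) [TopologicalSpace M] [ChartedSpace (E (d + 1)) M]
    [IsManifold (𝓡 (d + 1)) ∞ M] where
  val : ∀ x : M, TangentSpace (𝓡 (d + 1)) x →L[ℝ] TangentSpace (𝓡 (d + 1)) x →L[ℝ] ℝ
  symm : ∀ x v w, val x v w = val x w v
  signature : ∀ x, ∃ b : Module.Basis (Fin (d + 1)) ℝ (TangentSpace (𝓡 (d + 1)) x),
    ∀ i j, val x (b i) (b j) = if i = j then (if i = 0 then -1 else 1) else 0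
  contMDiff : ContMDiff (𝓡 (d + 1))
    ((𝓡 (d + 1)).prod 𝓘(ℝ, E (d + 1) →L[ℝ] E (d + 1) →L[ℝ] ℝ)) ∞
    (fun x => TotalSpace.mk' (E (d + 1) →L[ℝ] E (d + 1) →L[ℝ] ℝ)
      (E := fun x : M => TangentSpace (𝓡 (d + 1)) x →L[ℝ] TangentSpace (𝓡 (d + 1)) x →L[ℝ] ℝ)
      x (val x))

section Spacetime

variable {d : ℕ} {M : Type*} [TopologicalSpace M] [ChartedSpace (E (d + 1)) M]
  [IsManifold (𝓡 (d + 1)) ∞ M]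

/-- `D` is the Levi-Civita connection of `g`: the torsion-free (smooth) connection with
`X(g(Y, Z)) = g(∇_X Y, Z) + g(Y, ∇_X Z)`. -/
structure IsLeviCivita (g : LorentzianMetric d M)
    (D : CovariantDerivative (𝓡 (d + 1)) (E (d + 1))
      (TangentSpace (𝓡 (d + 1)) : M → Type _)) : Prop where
  smooth : SmoothConn D
  torsion : D.torsion = 0
  metric : ∀ (x : M) (X Y Z : VF (𝓡 (d + 1)) M), DiffAt X x → DiffAt Y x → DiffAt Z x →
    cov2 D (op2 g.val) X Y Z x = 0

/-- The deformation tensor `𝒦 = £_η g`. -/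
def deform (g : LorentzianMetric d M) (η : VF (𝓡 (d + 1)) M) : Cov2 (𝓡 (d + 1)) M :=
  lie2 η (op2 g.val)

end Spacetime

/-! ### Null hypersurface data -/

/-- The bilinear form `𝓐((W, a), (Z, b)) = γ(W, Z) + a ℓ(Z) + b ℓ(W) + a b ℓ⁽²⁾` on `V × ℝ`. -/
def ambientForm {V : Type*} [AddCommGroup V] [Module ℝ V] [TopologicalSpace V]
    [IsTopologicalAddGroup V] [ContinuousConstSMul ℝ V]
    (γ : V →L[ℝ] V →L[ℝ] ℝ) (ℓ : V →L[ℝ] ℝ) (l2 : ℝ) : LinearMap.BilinForm ℝ (V × ℝ) :=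
  LinearMap.mk₂ ℝ
    (fun x y => γ x.1 y.1 + x.2 * ℓ y.1 + y.2 * ℓ x.1 + x.2 * y.2 * l2)
    (by intro x y z; simp; ring) (by intro c x y; simp; ring)
    (by intro x y z; simp; ring) (by intro c x y; simp; ring)

/-- Null hypersurface data `{N, γ, ℓ, ℓ⁽²⁾, Y}` of dimension `d`. -/
structure NullData (d : ℕ) (N : Type*) [TopologicalSpace N] [ChartedSpace (E d) N]
    [IsManifold (𝓡 d) ∞ N] where
  γ : ∀ p : N, TangentSpace (𝓡 d) p →L[ℝ] TangentSpace (𝓡 d) p →L[ℝ] ℝ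
  ℓ : ∀ p : N, TangentSpace (𝓡 d) p →L[ℝ] ℝ
  l2 : N → ℝ
  Y : ∀ p : N, TangentSpace (𝓡 d) p →L[ℝ] TangentSpace (𝓡 d) p →L[ℝ] ℝ
  γ_symm : ∀ p v w, γ p v w = γ p w v
  /-- Together with the next field: `γ` has signature `(0, +, ..., +)`. -/
  γ_nonneg : ∀ p v, 0 ≤ γ p v v
  γ_radical : ∀ p, Module.finrank ℝ (LinearMap.ker (γ p).toLinearMap) = 1
  nondeg : ∀ p, (ambientForm (γ p) (ℓ p) (l2 p)).Nondegenerate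
  Y_symm : ∀ p v w, Y p v w = Y p w v
  γ_smooth : ContMDiff (𝓡 d) ((𝓡 d).prod 𝓘(ℝ, E d →L[ℝ] E d →L[ℝ] ℝ)) ∞
    (fun p => TotalSpace.mk' (E d →L[ℝ] E d →L[ℝ] ℝ)
      (E := fun p : N => TangentSpace (𝓡 d) p →L[ℝ] TangentSpace (𝓡 d) p →L[ℝ] ℝ) p (γ p))
  ℓ_smooth : ContMDiff (𝓡 d) ((𝓡 d).prod 𝓘(ℝ, E d →L[ℝ] ℝ)) ∞
    (fun p => TotalSpace.mk' (E d →L[ℝ] ℝ)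
      (E := fun p : N => TangentSpace (𝓡 d) p →L[ℝ] ℝ) p (ℓ p))
  l2_smooth : ContMDiff (𝓡 d) 𝓘(ℝ, ℝ) ∞ l2
  Y_smooth : ContMDiff (𝓡 d) ((𝓡 d).prod 𝓘(ℝ, E d →L[ℝ] E d →L[ℝ] ℝ)) ∞
    (fun p => TotalSpace.mk' (E d →L[ℝ] E d →L[ℝ] ℝ)
      (E := fun p : N => TangentSpace (𝓡 d) p →L[ℝ] TangentSpace (𝓡 d) p →L[ℝ] ℝ) p (Y p))

namespace NullData

variable {d : ℕ} {N : Type*} [TopologicalSpace N] [ChartedSpace (E d) N] [IsManifold (𝓡 d) ∞ N]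
  (S : NullData d N)

/-- The isomorphism from the dual of `T_p N × ℝ` to `T_p N × ℝ` inverse to `x ↦ 𝓐_p(x, ·)`. -/
def sharp (p : N) : Module.Dual ℝ (TangentSpace (𝓡 d) p × ℝ) ≃ₗ[ℝ] TangentSpace (𝓡 d) p × ℝ :=
  haveI : FiniteDimensional ℝ (TangentSpace (𝓡 d) p) :=
    inferInstanceAs (FiniteDimensional ℝ (E d))
  (LinearMap.BilinForm.toDual (ambientForm (S.γ p) (S.ℓ p) (S.l2 p)) (S.nondeg p)).symm

/-- The tensor `P`, i.e. `P(θ, θ')` is the value of the inverse of `𝓐` on `(θ, 0), (θ', 0)`. -/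
def P (p : N) (θ θ' : Module.Dual ℝ (TangentSpace (𝓡 d) p)) : ℝ :=
  θ' (S.sharp p (θ ∘ₗ LinearMap.fst ℝ _ ℝ)).1

/-- The vector field `n`, i.e. `θ(n)` is the value of the inverse of `𝓐` on `(0, 1), (θ, 0)`. -/
def n : VF (𝓡 d) N := fun p => (S.sharp p (LinearMap.snd ℝ _ ℝ)).1

/-- `F = dℓ / 2`. -/
def F : Cov2 (𝓡 d) N := fun X Z p => (1 / 2) * ext1 (op1 S.ℓ) X Z p

/-- `s = F(n, ·)`. -/
def s : Cov1 (𝓡 d) N := fun X p => S.F S.n X p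

/-- `U = £_n γ / 2`. -/
def U : Cov2 (𝓡 d) N := fun X Z p => (1 / 2) * lie2 S.n (op2 S.γ) X Z p

/-- `r = Y(n, ·)`. -/
def r : Cov1 (𝓡 d) N := fun X p => op2 S.Y S.n X p

/-- `D` is the metric hypersurface connection: the torsion-free (smooth) connection with
`∇_a γ_{bc} = - ℓ_b U_{ac} - ℓ_c U_{ab}` and `∇_a ℓ_b = F_{ab} - ℓ⁽²⁾ U_{ab}`. -/
structure IsMetricConn
    (D : CovariantDerivative (𝓡 d) (E d) (TangentSpace (𝓡 d) : N → Type _)) : Prop where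
  smooth : SmoothConn D
  torsion : D.torsion = 0
  cov_γ : ∀ (p : N) (X W Z : VF (𝓡 d) N), DiffAt X p → DiffAt W p → DiffAt Z p →
    cov2 D (op2 S.γ) X W Z p = - S.ℓ p (W p) * S.U X Z p - S.ℓ p (Z p) * S.U X W p
  cov_ℓ : ∀ (p : N) (X W : VF (𝓡 d) N), DiffAt X p → DiffAt W p →
    cov1 D (op1 S.ℓ) X W p = S.F X W p - S.l2 p * S.U X W p

end NullData

/-! ### Embedded data -/

section Embedded

variable {d : ℕ} {N : Type*} [TopologicalSpace N] [ChartedSpace (E d) N] [IsManifold (𝓡 d) ∞ N]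
  {M : Type*} [TopologicalSpace M] [ChartedSpace (E (d + 1)) M] [IsManifold (𝓡 (d + 1)) ∞ M]

/-- `φ_⋆ v`. -/
abbrev push (φ : N → M) (p : N) (v : TangentSpace (𝓡 d) p) : TangentSpace (𝓡 (d + 1)) (φ p) :=
  mfderiv (𝓡 d) (𝓡 (d + 1)) φ p v

/-- Near `φ p`, the vector field `Z` on `M` is a smooth extension of the vector field `ζ` along `φ`. -/
def Extends (φ : N → M) (ζ : ∀ p, TangentSpace (𝓡 (d + 1)) (φ p)) (p : N)
    (Z : VF (𝓡 (d + 1)) M) : Prop :=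
  SmoothAt Z (φ p) ∧ ∀ᶠ q in 𝓝 p, Z (φ q) = ζ q

/-- `ζ` is a rigging: a smooth vector field along `φ`, everywhere transverse to `φ(N)`. -/
structure IsRigging (φ : N → M) (ζ : ∀ p, TangentSpace (𝓡 (d + 1)) (φ p)) : Prop where
  smooth : ContMDiff (𝓡 d) (𝓡 (d + 1)).tangent ∞
    (fun p => (⟨φ p, ζ p⟩ : TangentBundle (𝓡 (d + 1)) M))
  transverse : ∀ p v, ζ p ≠ push φ p v

/-- The data `S` are `{φ, ζ}`-embedded in `(M, g)`. The pull-back `φ^⋆(£_ζ g)` does not depend on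
the extension of `ζ` off `φ(N)` by which it is computed. -/
structure IsEmbedded (S : NullData d N) (g : LorentzianMetric d M) (φ : N → M)
    (ζ : ∀ p, TangentSpace (𝓡 (d + 1)) (φ p)) : Prop where
  embedding : Manifold.IsSmoothEmbedding (𝓡 d) (𝓡 (d + 1)) ∞ φ
  rigging : IsRigging φ ζ
  γ_eq : ∀ p v w, g.val (φ p) (push φ p v) (push φ p w) = S.γ p v w
  ℓ_eq : ∀ p v, g.val (φ p) (ζ p) (push φ p v) = S.ℓ p v
  l2_eq : ∀ p, g.val (φ p) (ζ p) (ζ p) = S.l2 p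
  Y_eq : ∀ p Z, Extends φ ζ p Z → ∀ v w,
    (1 / 2) * at2 (lie2 Z (op2 g.val)) (φ p) (push φ p v) (push φ p w) = S.Y p v w

/-- `ν` is the vector field along `φ` that is metrically related to the normal covector of `φ(N)`
with value `1` on the rigging. -/
structure IsNormal (g : LorentzianMetric d M) (φ : N → M)
    (ζ ν : ∀ p, TangentSpace (𝓡 (d + 1)) (φ p)) : Prop where
  tangent : ∀ p v, g.val (φ p) (ν p) (push φ p v) = 0
  rigging : ∀ p, g.val (φ p) (ν p) (ζ p) = 1

variable (g : LorentzianMetric d M) (φ : N → M) (ζ : ∀ p, TangentSpace (𝓡 (d + 1)) (φ p))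
  (η : VF (𝓡 (d + 1)) M)

/-- `𝔭 = φ^⋆(𝒦(ζ, ζ))`. -/
def pScal : N → ℝ := fun p => at2 (deform g η) (φ p) (ζ p) (ζ p)

/-- `𝔴 = φ^⋆(𝒦(ζ, ν))`. -/
def wScal (ν : ∀ p, TangentSpace (𝓡 (d + 1)) (φ p)) : N → ℝ :=
  fun p => at2 (deform g η) (φ p) (ζ p) (ν p)

/-- `𝔮 = φ^⋆(𝒦(ζ, ·))`. -/
def qForm : Cov1 (𝓡 d) N := fun X p => at2 (deform g η) (φ p) (ζ p) (push φ p (X p))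

/-- `ℑ = φ^⋆(£_ζ 𝒦) / 2`, where `Z` is an extension of `ζ` off `φ(N)`, on which the result does not
depend. -/
def iTensor (Z : VF (𝓡 (d + 1)) M) : Cov2 (𝓡 d) N := fun X W p =>
  (1 / 2) * at2 (lie2 Z (deform g η)) (φ p) (push φ p (X p)) (push φ p (W p))

/-- `𝔅_{ab} = ∇°_{(a} 𝔮_{b)} + 𝔴 Y_{ab} + 𝔭 U_{ab} - ℑ_{ab}`. -/
def bTensor (S : NullData d N)
    (D : CovariantDerivative (𝓡 d) (E d) (TangentSpace (𝓡 d) : N → Type _))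
    (ν : ∀ p, TangentSpace (𝓡 (d + 1)) (φ p)) (Z : VF (𝓡 (d + 1)) M) : Cov2 (𝓡 d) N :=
  fun X W p =>
    (1 / 2) * (cov1 D (qForm g φ ζ η) X W p + cov1 D (qForm g φ ζ η) W X p)
      + wScal g φ ζ η ν p * op2 S.Y X W p + pScal g φ ζ η p * S.U X W p
      - iTensor g φ η Z X W p

/-- `Σ(φ_⋆ X, φ_⋆ W)` along `φ`, where `Σ = £_η ∇`. -/
def sigma (D : CovariantDerivative (𝓡 (d + 1)) (E (d + 1))
      (TangentSpace (𝓡 (d + 1)) : M → Type _))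
    (X W : VF (𝓡 d) N) (p : N) : TangentSpace (𝓡 (d + 1)) (φ p) :=
  at2 (lieConn D η) (φ p) (push φ p (X p)) (push φ p (W p))

/-- `∇°_a ∇°_b α + 2 (∇°_{(a} α)(s_{b)} - r_{b)}) + 2 α ∇°_{(a} s_{b)} + n(α) Y_{ab}
- α (£_n Y)_{ab}`. -/
def nuCoeff (S : NullData d N)
    (D : CovariantDerivative (𝓡 d) (E d) (TangentSpace (𝓡 d) : N → Type _)) (α : N → ℝ)
    (X W : VF (𝓡 d) N) (p : N) : ℝ :=
  cov1 D (dOp α) X W p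
    + (dir X α p * (S.s W p - S.r W p) + dir W α p * (S.s X p - S.r X p))
    + α p * (cov1 D S.s X W p + cov1 D S.s W X p)
    + dir S.n α p * op2 S.Y X W p - α p * lie2 S.n (op2 S.Y) X W p

end Embedded

end NullHyp

end

noncomputable section

set_option linter.unusedSectionVars false

namespace NullHyp

section LocalCalculus

variable {E : Type*} [NormedAddCommGroup E] [NormedSpace ℝ E]
  {H : Type*} [TopologicalSpace H] {I : ModelWithCorners ℝ E H}
  {M : Type*} [TopologicalSpace M] [ChartedSpace H M] [IsManifold I ∞ M]

/-- The function `f` is differentiable at `x`. -/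
abbrev FDiffAt (I : ModelWithCorners ℝ E H) (f : M → ℝ) (x : M) : Prop :=
  MDifferentiableAt I 𝓘(ℝ, ℝ) f x

/-- The vector field `X` is `C^∞` on a neighbourhood of `x`. -/
def SmoothNear (X : VF I M) (x : M) : Prop := ∀ᶠ y in 𝓝 x, SmoothAt X y

/-- Fields of bilinear forms on the tangent spaces. -/
abbrev BilinField (I : ModelWithCorners ℝ E H) (M : Type*) [TopologicalSpace M] [ChartedSpace H M]
    [IsManifold I ∞ M] := ∀ x : M, TangentSpace I x →L[ℝ] TangentSpace I x →L[ℝ] ℝ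

/-- The field of bilinear forms `T` takes differentiable vector fields to differentiable
functions. -/
def BilinDiffAt (T : BilinField I M) (x : M) : Prop :=
  ∀ X Y : VF I M, DiffAt X x → DiffAt Y x → FDiffAt I (op2 T X Y) x

lemma SmoothAt.diffAt {X : VF I M} {x : M} (h : SmoothAt X x) : DiffAt X x :=
  ContMDiffAt.mdifferentiableAt h (by simp)

lemma SmoothNear.smoothAt {X : VF I M} {x : M} (h : SmoothNear X x) : SmoothAt X x :=
  h.self_of_nhds

lemma SmoothNear.diffAt {X : VF I M} {x : M} (h : SmoothNear X x) : DiffAt X x :=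
  h.smoothAt.diffAt

lemma SmoothNear.eventually {X : VF I M} {x : M} (h : SmoothNear X x) :
    ∀ᶠ y in 𝓝 x, SmoothNear X y :=
  eventually_eventually_nhds.2 h

lemma SmoothAt.smul {f : M → ℝ} {X : VF I M} {x : M} (hf : ContMDiffAt I 𝓘(ℝ, ℝ) ∞ f x)
    (hX : SmoothAt X x) : SmoothAt (f • X) x :=
  ContMDiffAt.smul_section hf hX

lemma DiffAt.smul {f : M → ℝ} {X : VF I M} {x : M} (hf : FDiffAt I f x)
    (hX : DiffAt X x) : DiffAt (f • X) x :=
  MDifferentiableAt.smul_section hf hX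

lemma smoothNear_extend {x : M} (v : TangentSpace I x) :
    SmoothNear (FiberBundle.extend E v) x := by
  obtain ⟨s, hs, h⟩ := FiberBundle.exists_contMDiffOn_extend (k := ∞) I E v
  obtain ⟨t, hts, ht, hxt⟩ := mem_nhds_iff.1 hs
  filter_upwards [ht.mem_nhds hxt] with y hy
  exact (h.mono hts).contMDiffAt (ht.mem_nhds hy)

lemma extend_self {x : M} (v : TangentSpace I x) :
    (FiberBundle.extend E v : VF I M) x = v := by
  simp

section Dir

variable {X Y : VF I M} {f h : M → ℝ} {x : M}

lemma dir_add (hf : FDiffAt I f x) (hh : FDiffAt I h x) :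
    dir X (fun y => f y + h y) x = dir X f x + dir X h x := by
  have := congrArg (fun L => L (X x)) (mvfderiv_add hf hh)
  exact this

lemma dir_sub (hf : FDiffAt I f x) (hh : FDiffAt I h x) :
    dir X (fun y => f y - h y) x = dir X f x - dir X h x := by
  have := congrArg (fun L => L (X x)) (mvfderiv_sub hf hh)
  exact this

lemma dir_mul (hf : FDiffAt I f x) (hh : FDiffAt I h x) :
    dir X (fun y => f y * h y) x = f x * dir X h x + h x * dir X f x := by
  have := congrArg (fun L => L (X x)) (mvfderiv_mul hf hh)
  exact this

lemma dir_const (c : ℝ) : dir X (fun _ : M => c) x = 0 := by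
  simp [dir, mvfderiv_const]

lemma dir_const_mul (c : ℝ) (hf : FDiffAt I f x) :
    dir X (fun y => c * f y) x = c * dir X f x := by
  rw [dir_mul mdifferentiableAt_const hf, dir_const]; ring

lemma dir_congr (hfh : f =ᶠ[𝓝 x] h) : dir X f x = dir X h x := by
  simp only [dir, mvfderiv]
  rw [hfh.mfderiv_eq, hfh.self_of_nhds]

lemma dir_smul_field : dir (h • X) f x = h x * dir X f x := by
  simp [dir]

lemma SmoothAt.dir (hX : SmoothAt X x) (hf : ContMDiffAt I 𝓘(ℝ, ℝ) ∞ f x) :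
    ContMDiffAt I 𝓘(ℝ, ℝ) ∞ (dir X f) x := by
  have h1 := hf.mfderiv_const (m := ∞) (by simp)
  have h2 := ContMDiffAt.clm_apply_of_inCoordinates (F₁ := E) (F₂ := ℝ)
    (E₁ := TangentSpace I (M := M)) (E₂ := TangentSpace 𝓘(ℝ, ℝ) (M := ℝ)) h1 hX hf
  rw [contMDiffAt_totalSpace] at h2
  have h3 := h2.2
  simp only [trivializationAt_model_space_apply] at h3
  exact h3

end Dir

lemma isManifold_minSmoothness_three : IsManifold I (minSmoothness ℝ 3) M :=
  IsManifold.of_le (n := ∞) (by simpa using! ENat.LEInfty.out)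

section Bracket

variable [FiniteDimensional ℝ E] {X Y Z : VF I M} {f : M → ℝ} {x : M}

open VectorField

lemma SmoothAt.bracket (hX : SmoothAt X x) (hY : SmoothAt Y x) :
    SmoothAt (mlieBracket I X Y) x := by
  have : CompleteSpace E := FiniteDimensional.complete ℝ E
  have : IsManifold I (((⊤ : ℕ∞) : ℕ∞ω) + 1) M := by simpa
  have : IsManifold I (minSmoothness ℝ 3) M := isManifold_minSmoothness_three
  exact ContMDiffAt.mlieBracket_vectorField (m := ⊤) (n := ⊤) hX hY (by simp)

lemma SmoothNear.bracket (hX : SmoothNear X x) (hY : SmoothNear Y x) :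
    SmoothNear (mlieBracket I X Y) x := by
  filter_upwards [hX, hY] with y h1 h2 using h1.bracket h2

lemma bracket_smul_right (hf : FDiffAt I f x) (hY : DiffAt Y x) :
    mlieBracket I X (f • Y) x = dir X f x • Y x + f x • mlieBracket I X Y x := by
  have : CompleteSpace E := FiniteDimensional.complete ℝ E
  exact mlieBracket_smul_right hf hY

lemma bracket_smul_left (hf : FDiffAt I f x) (hX : DiffAt X x) :
    mlieBracket I (f • X) Y x = -(dir Y f x • X x) + f x • mlieBracket I X Y x := by
  have : CompleteSpace E := FiniteDimensional.complete ℝ E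
  rw [mlieBracket_smul_left hf hX]
  simp [dir]

lemma bracket_add_right (hY : DiffAt Y x) (hZ : DiffAt Z x) :
    mlieBracket I X (Y + Z) x = mlieBracket I X Y x + mlieBracket I X Z x := by
  have : CompleteSpace E := FiniteDimensional.complete ℝ E
  exact mlieBracket_add_right hY hZ

lemma bracket_swap : mlieBracket I X Y x = -mlieBracket I Y X x :=
  mlieBracket_swap_apply

lemma bracket_congr {X' Y' : VF I M} (hX : X =ᶠ[𝓝 x] X') (hY : Y =ᶠ[𝓝 x] Y') :
    mlieBracket I X Y x = mlieBracket I X' Y' x :=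
  hX.mlieBracket_vectorField_eq hY

lemma jacobi (hX : SmoothAt X x) (hY : SmoothAt Y x) (hZ : SmoothAt Z x) :
    mlieBracket I X (mlieBracket I Y Z) x =
      mlieBracket I (mlieBracket I X Y) Z x + mlieBracket I Y (mlieBracket I X Z) x := by
  have : CompleteSpace E := FiniteDimensional.complete ℝ E
  have h2 : minSmoothness ℝ 2 ≤ (∞ : ℕ∞ω) := by simpa using! ENat.LEInfty.out
  have : IsManifold I (minSmoothness ℝ 3) M := isManifold_minSmoothness_three
  exact leibniz_identity_mlieBracket_apply (ContMDiffAt.of_le hX h2) (ContMDiffAt.of_le hY h2)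
    (ContMDiffAt.of_le hZ h2)

/-- `[X, Y](f) = X(Y(f)) - Y(X(f))`, from the Leibniz rule and the Jacobi identity. -/
lemma dir_bracket (hX : SmoothNear X x) (hY : SmoothNear Y x)
    (hf : ∀ᶠ y in 𝓝 x, ContMDiffAt I 𝓘(ℝ, ℝ) ∞ f y) :
    dir (mlieBracket I X Y) f x = dir X (dir Y f) x - dir Y (dir X f) x := by
  by_cases hE : ∃ v : TangentSpace I x, v ≠ 0
  swap
  · push Not at hE
    simp only [dir, hE, map_zero, sub_zero]
  obtain ⟨v, hv⟩ := hE
  set Z : VF I M := FiberBundle.extend E v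
  have hZ : SmoothNear Z x := smoothNear_extend v
  have key : ∀ {A B : VF I M}, SmoothNear A x → SmoothNear B x →
      mlieBracket I A (mlieBracket I B (f • Z)) x =
        dir A (dir B f) x • Z x + dir B f x • mlieBracket I A Z x
          + (dir A f x • mlieBracket I B Z x + f x • mlieBracket I A (mlieBracket I B Z) x) := by
    intro A B hA hB
    have h1 : mlieBracket I B (f • Z) =ᶠ[𝓝 x] dir B f • Z + f • mlieBracket I B Z := by
      filter_upwards [hf, hZ] with y h1 h2
      exact bracket_smul_right (h1.mdifferentiableAt (by simp)) h2.diffAt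
    have hBf := (hB.smoothAt.dir hf.self_of_nhds).mdifferentiableAt (by simp)
    have hf' := hf.self_of_nhds.mdifferentiableAt (n := ∞) (by simp)
    rw [bracket_congr (Filter.EventuallyEq.refl _ A) h1, bracket_add_right (hZ.diffAt.smul hBf)
      ((hB.bracket hZ).diffAt.smul hf'), bracket_smul_right hBf hZ.diffAt,
      bracket_smul_right hf' (hB.bracket hZ).diffAt]
  have h3 := jacobi hX.smoothAt hY.smoothAt (hZ.smoothAt.smul hf.self_of_nhds)
  rw [key hX hY, key hY hX, bracket_smul_right (hf.self_of_nhds.mdifferentiableAt (by simp))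
    hZ.diffAt, jacobi hX.smoothAt hY.smoothAt hZ.smoothAt] at h3
  have h4 : (dir (mlieBracket I X Y) f x - (dir X (dir Y f) x - dir Y (dir X f) x)) • Z x = 0 := by
    linear_combination (norm := module) (-1 : ℝ) • h3
  have hZx : Z x = v := extend_self v
  rw [hZx, smul_eq_zero] at h4
  linarith [h4.resolve_right hv]

end Bracket

end LocalCalculus

section Connections

open VectorField

variable {E : Type*} [NormedAddCommGroup E] [NormedSpace ℝ E] [FiniteDimensional ℝ E]
  {H : Type*} [TopologicalSpace H] {I : ModelWithCorners ℝ E H}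
  {M : Type*} [TopologicalSpace M] [ChartedSpace H M] [IsManifold I ∞ M]

/-- The field of bilinear forms `T` takes smooth vector fields to smooth functions. -/
def BilinSmoothAt (T : BilinField I M) (x : M) : Prop :=
  ∀ X Y : VF I M, SmoothAt X x → SmoothAt Y x → ContMDiffAt I 𝓘(ℝ, ℝ) ∞ (op2 T X Y) x

lemma bilinSmoothAt_of_contMDiff {T : BilinField I M}
    (hT : ContMDiff I (I.prod 𝓘(ℝ, E →L[ℝ] E →L[ℝ] ℝ)) ∞
      (fun x => TotalSpace.mk' (E →L[ℝ] E →L[ℝ] ℝ)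
        (E := fun x : M => TangentSpace I x →L[ℝ] TangentSpace I x →L[ℝ] ℝ) x (T x))) (x : M) :
    BilinSmoothAt T x := by
  intro X Y hX hY
  have : ContMDiffAt I (I.prod 𝓘(ℝ)) ∞
      (fun m => TotalSpace.mk' ℝ (E := Bundle.Trivial M ℝ) m (T m (X m) (Y m))) x := by
    apply ContMDiffAt.clm_bundle_apply₂ (F₁ := E) (F₂ := E)
    · exact hT x
    · exact hX
    · exact hY
  simp only [contMDiffAt_totalSpace] at this
  exact this.2

lemma bilinDiffAt_of_contMDiff {T : BilinField I M}
    (hT : ContMDiff I (I.prod 𝓘(ℝ, E →L[ℝ] E →L[ℝ] ℝ)) ∞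
      (fun x => TotalSpace.mk' (E →L[ℝ] E →L[ℝ] ℝ)
        (E := fun x : M => TangentSpace I x →L[ℝ] TangentSpace I x →L[ℝ] ℝ) x (T x))) (x : M) :
    BilinDiffAt T x := by
  intro X Y hX hY
  have : MDifferentiableAt I (I.prod 𝓘(ℝ))
      (fun m => TotalSpace.mk' ℝ (E := Bundle.Trivial M ℝ) m (T m (X m) (Y m))) x := by
    apply MDifferentiableAt.clm_bundle_apply₂ (F₁ := E) (F₂ := E)
    · exact (hT x).mdifferentiableAt (by simp)
    · exact hX
    · exact hY
  simp only [mdifferentiableAt_totalSpace] at this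
  exact this.2

lemma contMDiffAt_op1 {θ : ∀ x : M, TangentSpace I x →L[ℝ] ℝ}
    (hθ : ContMDiff I (I.prod 𝓘(ℝ, E →L[ℝ] ℝ)) ∞
      (fun x => TotalSpace.mk' (E →L[ℝ] ℝ)
        (E := fun x : M => TangentSpace I x →L[ℝ] ℝ) x (θ x))) {X : VF I M} {x : M}
    (hX : SmoothAt X x) : ContMDiffAt I 𝓘(ℝ, ℝ) ∞ (op1 θ X) x := by
  have : ContMDiffAt I (I.prod 𝓘(ℝ)) ∞
      (fun m => TotalSpace.mk' ℝ (E := Bundle.Trivial M ℝ) m (θ m (X m))) x := by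
    apply ContMDiffAt.clm_bundle_apply (F₁ := E)
    · exact hθ x
    · exact hX
  simp only [contMDiffAt_totalSpace] at this
  exact this.2

/-- `[X, Y] = ∇_X Y - ∇_Y X` for differentiable vector fields. -/
def TorsionFree (D : CovariantDerivative I E (TangentSpace I : M → Type _)) : Prop :=
  ∀ (x : M) (X Y : VF I M), DiffAt X x → DiffAt Y x →
    mlieBracket I X Y x = cov D X Y x - cov D Y X x

variable {D : CovariantDerivative I E (TangentSpace I : M → Type _)} {T : BilinField I M}
  {X Y W V Z η : VF I M} {f : M → ℝ} {x : M}

lemma cov_add_right (hY : DiffAt Y x) (hW : DiffAt W x) :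
    cov D X (Y + W) x = cov D X Y x + cov D X W x := by
  simp only [cov]
  rw [D.isCovariantDerivativeOnUniv.add hY hW]
  rfl

lemma cov_smul_right (hf : FDiffAt I f x) (hY : DiffAt Y x) :
    cov D X (f • Y) x = f x • cov D X Y x + dir X f x • Y x := by
  simp only [cov]
  rw [D.isCovariantDerivativeOnUniv.leibniz hY hf]
  rfl

lemma SmoothNear.exists_open (hX : SmoothNear X x) :
    ∃ u, IsOpen u ∧ x ∈ u ∧ ∀ y ∈ u, SmoothAt X y := by
  obtain ⟨u, h1, h2, h3⟩ := eventually_nhds_iff.1 hX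
  exact ⟨u, h2, h3, h1⟩

lemma contMDiffAt_conn (hD : SmoothConn D) (hX : SmoothNear X x) :
    ContMDiffAt I (I.prod 𝓘(ℝ, E →L[ℝ] E)) ∞ (fun y => TotalSpace.mk' (E →L[ℝ] E)
      (E := fun y : M => TangentSpace I y →L[ℝ] TangentSpace I y) y (D X y)) x := by
  obtain ⟨u, hu, hxu, h⟩ := hX.exists_open
  have h1 := (hD u hu).contMDiff (σ := X) (fun y hy => (h y hy).contMDiffWithinAt)
  exact h1.contMDiffAt (hu.mem_nhds hxu)

lemma SmoothNear.cov (hD : SmoothConn D) (hX : SmoothNear X x) (hY : SmoothNear Y x) :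
    SmoothNear (cov D X Y) x := by
  filter_upwards [hX, hY.eventually] with y h1 h2
  exact ContMDiffAt.clm_bundle_apply (F₁ := E) (F₂ := E) (contMDiffAt_conn hD h2) h1

lemma DiffAt.cov (hD : SmoothConn D) (hX : DiffAt X x) (hY : SmoothNear Y x) :
    DiffAt (cov D X Y) x :=
  MDifferentiableAt.clm_bundle_apply (F₁ := E) (F₂ := E)
    ((contMDiffAt_conn hD hY).mdifferentiableAt (by simp)) hX

lemma tensorialAt_cov2_left (hT : BilinDiffAt T x) (hW : DiffAt W x) :
    TensorialAt I E (fun Y => cov2 D (op2 T) X Y W x) x where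
  smul {f Y} hf hY := by
    have h1 : op2 T (f • Y) W = fun y => f y * op2 T Y W y := by
      ext y; simp [op2]
    simp only [cov2]
    rw [h1, dir_mul hf (hT Y W hY hW)]
    simp only [op2, cov_smul_right hf hY, Pi.smul_apply', map_add, map_smul]
    simp
    ring
  add {Y Y'} hY hY' := by
    have h1 : op2 T (Y + Y') W = fun y => op2 T Y W y + op2 T Y' W y := by
      ext y; simp [op2]
    simp only [cov2]
    rw [h1, dir_add (hT Y W hY hW) (hT Y' W hY' hW)]
    simp only [op2, cov_add_right hY hY', Pi.add_apply, map_add]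
    simp
    ring

lemma tensorialAt_cov2_right (hT : BilinDiffAt T x) (hY : DiffAt Y x) :
    TensorialAt I E (fun W => cov2 D (op2 T) X Y W x) x where
  smul {f W} hf hW := by
    have h1 : op2 T Y (f • W) = fun y => f y * op2 T Y W y := by
      ext y; simp [op2]
    simp only [cov2]
    rw [h1, dir_mul hf (hT Y W hY hW)]
    simp only [op2, cov_smul_right hf hW, Pi.smul_apply', map_add, map_smul]
    simp
    ring
  add {W W'} hW hW' := by
    have h1 : op2 T Y (W + W') = fun y => op2 T Y W y + op2 T Y W' y := by
      ext y; simp [op2]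
    simp only [cov2]
    rw [h1, dir_add (hT Y W hY hW) (hT Y W' hY hW')]
    simp only [op2, cov_add_right hW hW', Pi.add_apply, map_add]
    ring

/-- `(∇_X T)(Y, W)` depends only on the values of the vector fields at the point. -/
lemma cov2_congr_values (hT : BilinDiffAt T x) {X' Y' W' : VF I M}
    (hY : DiffAt Y x) (hY' : DiffAt Y' x) (hW : DiffAt W x) (hW' : DiffAt W' x)
    (hXX : X x = X' x) (hYY : Y x = Y' x) (hWW : W x = W' x) :
    cov2 D (op2 T) X Y W x = cov2 D (op2 T) X' Y' W' x := by
  have h1 : cov2 D (op2 T) X Y W x = cov2 D (op2 T) X' Y W x := by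
    simp only [cov2, op2, cov, dir, hXX]
  rw [h1]
  exact TensorialAt.pointwise₂ (Φ := fun Y W => cov2 D (op2 T) X' Y W x)
    (fun _ h => tensorialAt_cov2_left hT h) (fun _ h => tensorialAt_cov2_right hT h)
    hY hY' hW hW' hYY hWW

lemma lie2_eq_cov2 (hD : TorsionFree D) (hX : DiffAt X x) (hY : DiffAt Y x) (hW : DiffAt W x) :
    lie2 X (op2 T) Y W x = cov2 D (op2 T) X Y W x
      + T x (cov D Y X x) (W x) + T x (Y x) (cov D W X x) := by
  simp only [lie2, cov2, op2, hD x X Y hX hY, hD x X W hX hW, map_sub]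
  simp
  ring

/-- The value of `£_X T` at a point depends only on the values of its arguments there. -/
lemma lie2_congr_values (hD : TorsionFree D) (hT : BilinDiffAt T x) {Y' W' : VF I M}
    (hX : DiffAt X x) (hY : DiffAt Y x) (hY' : DiffAt Y' x) (hW : DiffAt W x) (hW' : DiffAt W' x)
    (hYY : Y x = Y' x) (hWW : W x = W' x) :
    lie2 X (op2 T) Y W x = lie2 X (op2 T) Y' W' x := by
  rw [lie2_eq_cov2 hD hX hY hW, lie2_eq_cov2 hD hX hY' hW',
    cov2_congr_values hT hY hY' hW hW' rfl hYY hWW]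
  simp only [cov, hYY, hWW]

/-- The bilinear form `T(∇_v η, w) + T(v, ∇_w η)`. It agrees with `£_η T` when `∇_η T = 0`. -/
def deformBilin (D : CovariantDerivative I E (TangentSpace I : M → Type _)) (T : BilinField I M)
    (η : VF I M) : BilinField I M := fun x =>
  (T x) ∘L (D η x) + (ContinuousLinearMap.precomp ℝ (D η x)) ∘L (T x)

lemma deformBilin_apply (v w : TangentSpace I x) :
    deformBilin D T η x v w = T x (D η x v) w + T x v (D η x w) := rfl

lemma deformBilin_symm (hT : ∀ v w, T x v w = T x w v) (v w : TangentSpace I x) :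
    deformBilin D T η x v w = deformBilin D T η x w v := by
  rw [deformBilin_apply, deformBilin_apply, hT _ w, hT v]; ring

lemma lie2_eq_deformBilin (hD : TorsionFree D) (hX : DiffAt X x) (hY : DiffAt Y x)
    (hW : DiffAt W x) (h : cov2 D (op2 T) X Y W x = 0) :
    lie2 X (op2 T) Y W x = op2 (deformBilin D T X) Y W x := by
  rw [lie2_eq_cov2 hD hX hY hW, h]
  simp [op2, deformBilin_apply, cov]

lemma bilinDiffAt_deformBilin (hD : SmoothConn D) (hT : BilinDiffAt T x) (hη : SmoothNear η x) :
    BilinDiffAt (deformBilin D T η) x := by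
  intro X Y hX hY
  have h1 := hT _ _ (hX.cov hD hη) hY
  have h2 := hT _ _ hX (hY.cov hD hη)
  exact h1.add h2

/-- The cyclic combination of the derivatives of a symmetric tensor, for a torsion-free
connection. -/
lemma cov2_cyclic (hD : TorsionFree D) (hs : ∀ v w, T x v w = T x w v)
    (hX : DiffAt X x) (hW : DiffAt W x) (hV : DiffAt V x) :
    cov2 D (op2 T) X W V x + cov2 D (op2 T) W X V x - cov2 D (op2 T) V X W x =
      dir X (op2 T W V) x + dir W (op2 T X V) x - lie2 V (op2 T) X W x
        - T x (cov D X W x + cov D W X x) (V x) := by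
  simp only [cov2, lie2, op2, hD x V X hV hX, hD x V W hV hW, map_sub, map_add]
  simp only [add_apply, sub_apply]
  rw [hs (W x) (cov D X V x), hs (X x) (cov D W V x)]
  rw [hs (cov D X V x) (W x), hs (X x) (cov D V W x)]
  ring

end Connections

section LieConnection

open VectorField

variable {E : Type*} [NormedAddCommGroup E] [NormedSpace ℝ E] [FiniteDimensional ℝ E]
  {H : Type*} [TopologicalSpace H] {I : ModelWithCorners ℝ E H}
  {M : Type*} [TopologicalSpace M] [ChartedSpace H M] [IsManifold I ∞ M]
  {D : CovariantDerivative I E (TangentSpace I : M → Type _)} {T : BilinField I M}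
  {X Y W V Z η : VF I M} {f : M → ℝ} {x : M}

/-- `D` is metric for the bilinear field `T`. -/
def Compatible (D : CovariantDerivative I E (TangentSpace I : M → Type _))
    (T : BilinField I M) : Prop :=
  ∀ (x : M) (X Y Z : VF I M), DiffAt X x → DiffAt Y x → DiffAt Z x →
    cov2 D (op2 T) X Y Z x = 0

lemma Compatible.dir (hc : Compatible D T) (hX : DiffAt X x) (hY : DiffAt Y x)
    (hW : DiffAt W x) :
    dir X (op2 T Y W) x = op2 T (cov D X Y) W x + op2 T Y (cov D X W) x := by
  have := hc x X Y W hX hY hW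
  simp only [cov2] at this
  linarith

lemma SmoothNear.op2 (hT : ∀ y, BilinSmoothAt T y) (hX : SmoothNear X x) (hY : SmoothNear Y x) :
    ∀ᶠ y in 𝓝 x, ContMDiffAt I 𝓘(ℝ, ℝ) ∞ (op2 T X Y) y := by
  filter_upwards [hX, hY] with y h1 h2 using hT y X Y h1 h2

lemma fdiffAt_op2 (hT : BilinSmoothAt T x) (hX : SmoothNear X x) (hY : SmoothNear Y x) :
    FDiffAt I (op2 T X Y) x :=
  (hT X Y hX.smoothAt hY.smoothAt).mdifferentiableAt (by simp)

lemma fdiffAt_dir_op2 (hT : BilinSmoothAt T x) (hZ : SmoothNear Z x) (hX : SmoothNear X x)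
    (hY : SmoothNear Y x) : FDiffAt I (NullHyp.dir Z (NullHyp.op2 T X Y)) x :=
  (hZ.smoothAt.dir (hT X Y hX.smoothAt hY.smoothAt)).mdifferentiableAt (by simp)

lemma dir_lie2 (hT : ∀ y, BilinSmoothAt T y) (hZ : SmoothNear Z x) (hX : SmoothNear X x)
    (hY : SmoothNear Y x) :
    NullHyp.dir V (lie2 Z (NullHyp.op2 T) X Y) x =
      NullHyp.dir V (NullHyp.dir Z (NullHyp.op2 T X Y)) x
        - NullHyp.dir V (NullHyp.op2 T (mlieBracket I Z X) Y) x
        - NullHyp.dir V (NullHyp.op2 T X (mlieBracket I Z Y)) x := by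
  have h1 := fdiffAt_dir_op2 (hT x) hZ hX hY
  have h2 := fdiffAt_op2 (hT x) (hZ.bracket hX) hY
  have h3 := fdiffAt_op2 (hT x) hX (hZ.bracket hY)
  have := dir_sub (X := V) (h1.sub h2) h3
  simp only [Pi.sub_apply] at this
  rw [← dir_sub h1 h2]
  exact this

/-- `(∇_X £_η T)(W, V) = T(Σ(X, W), V) + T(W, Σ(X, V))` for `Σ = £_η ∇` and parallel `T`. -/
lemma cov2_lie2_eq (hDs : SmoothConn D) (hD : TorsionFree D) (hT : ∀ y, BilinSmoothAt T y)
    (hc : Compatible D T) (hη : SmoothNear η x) (hX : SmoothNear X x) (hW : SmoothNear W x)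
    (hV : SmoothNear V x) :
    cov2 D (op2 (deformBilin D T η)) X W V x =
      T x (lieConn D η X W x) (V x) + T x (W x) (lieConn D η X V x) := by
  have hK : ∀ {A B : VF I M} {y : M}, DiffAt η y → DiffAt A y → DiffAt B y →
      op2 (deformBilin D T η) A B y = lie2 η (op2 T) A B y := fun h1 h2 h3 =>
    (lie2_eq_deformBilin hD h1 h2 h3 (hc _ _ _ _ h1 h2 h3)).symm
  have hXW := hX.cov hDs hW
  have hXV := hX.cov hDs hV
  have h1 : dir X (op2 (deformBilin D T η) W V) x = dir X (lie2 η (op2 T) W V) x := by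
    refine dir_congr ?_
    filter_upwards [hη, hW, hV] with y h1 h2 h3 using hK h1.diffAt h2.diffAt h3.diffAt
  have h2 := dir_bracket hη hX (SmoothNear.op2 hT hW hV)
  have h3 : dir η (dir X (op2 T W V)) x
      = dir η (op2 T (cov D X W) V) x + dir η (op2 T W (cov D X V)) x := by
    rw [← dir_add (fdiffAt_op2 (hT x) hXW hV) (fdiffAt_op2 (hT x) hW hXV)]
    refine dir_congr ?_
    filter_upwards [hX, hW, hV] with y h1 h2 h3 using hc.dir h1.diffAt h2.diffAt h3.diffAt
  have h8 := hc.dir (hη.bracket hX).diffAt hW.diffAt hV.diffAt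
  have h6 := hc.dir hX.diffAt (hη.bracket hW).diffAt hV.diffAt
  have h7 := hc.dir hX.diffAt hW.diffAt (hη.bracket hV).diffAt
  have h4 := hK hη.diffAt hXW.diffAt hV.diffAt
  have h5 := hK hη.diffAt hW.diffAt hXV.diffAt
  rw [dir_lie2 hT hη hW hV] at h1
  simp only [lie2] at h4 h5
  rw [cov2, h1, h4, h5, h6, h7]
  rw [h8, h3] at h2
  simp only [lieConn, op2, map_sub, sub_apply] at *
  linarith

/-- `£_η ∇` is symmetric when `∇` is torsion-free. -/
lemma lieConn_symm (hDs : SmoothConn D) (hD : TorsionFree D)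
    (hη : SmoothNear η x) (hX : SmoothNear X x) (hW : SmoothNear W x) :
    lieConn D η X W x = lieConn D η W X x := by
  have h1 := jacobi hη.smoothAt hX.smoothAt hW.smoothAt
  have h2 : mlieBracket I X W =ᶠ[𝓝 x] cov D X W + (-1 : ℝ) • cov D W X := by
    filter_upwards [hX, hW] with y h1 h2
    rw [hD y X W h1.diffAt h2.diffAt]
    simp [sub_eq_add_neg]
    rfl
  have h3 : mlieBracket I η (mlieBracket I X W) x
      = mlieBracket I η (cov D X W) x - mlieBracket I η (cov D W X) x := by
    have : CompleteSpace E := FiniteDimensional.complete ℝ E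
    have hXW : DiffAt (cov D X W) x := (hX.cov hDs hW).diffAt
    have hWX : DiffAt (cov D W X) x := (hW.cov hDs hX).diffAt
    have hWX' : DiffAt ((-1 : ℝ) • cov D W X) x :=
      hWX.smul (f := fun _ => (-1 : ℝ)) mdifferentiableAt_const
    rw [bracket_congr (Filter.EventuallyEq.refl _ η) h2, bracket_add_right hXW hWX',
      mlieBracket_const_smul_right hWX]
    simp [sub_eq_add_neg]
  rw [h3, hD x _ W (hη.bracket hX).diffAt hW.diffAt, hD x X _ hX.diffAt (hη.bracket hW).diffAt]
    at h1
  simp only [lieConn]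
  linear_combination (norm := module) (1 : ℝ) • h1

/-- `£_η ∇` in terms of the deformation tensor. -/
lemma two_mul_lieConn (hDs : SmoothConn D) (hD : TorsionFree D) (hT : ∀ y, BilinSmoothAt T y)
    (hs : ∀ y v w, T y v w = T y w v)
    (hc : Compatible D T) (hη : SmoothNear η x) (hX : SmoothNear X x) (hW : SmoothNear W x)
    (hV : SmoothNear V x) :
    2 * T x (lieConn D η X W x) (V x) =
      cov2 D (op2 (deformBilin D T η)) X W V x + cov2 D (op2 (deformBilin D T η)) W X V x
        - cov2 D (op2 (deformBilin D T η)) V X W x := by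
  rw [cov2_lie2_eq hDs hD hT hc hη hX hW hV, cov2_lie2_eq hDs hD hT hc hη hW hX hV,
    cov2_lie2_eq hDs hD hT hc hη hV hX hW, lieConn_symm hDs hD hη hV hX,
    lieConn_symm hDs hD hη hV hW, lieConn_symm hDs hD hη hW hX,
    hs x (lieConn D η X V x) (W x)]
  ring

/-- `£_Z £_η T - £_η £_Z T = £_{[Z, η]} T`. -/
lemma lie2_lie2_sub (hT : ∀ y, BilinSmoothAt T y) (hZ : SmoothNear Z x) (hη : SmoothNear η x)
    (hX : SmoothNear X x) (hW : SmoothNear W x) :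
    lie2 Z (lie2 η (op2 T)) X W x =
      lie2 η (lie2 Z (op2 T)) X W x + lie2 (mlieBracket I Z η) (op2 T) X W x := by
  have h1 := dir_bracket hZ hη (SmoothNear.op2 hT hX hW)
  have h2 := jacobi hZ.smoothAt hη.smoothAt hX.smoothAt
  have h3 := jacobi hZ.smoothAt hη.smoothAt hW.smoothAt
  have e1 := dir_lie2 (V := Z) hT hη hX hW
  have e2 := dir_lie2 (V := η) hT hZ hX hW
  simp only [lie2] at e1 e2 ⊢
  rw [e1, e2, h1]
  simp only [op2, h2, h3, map_add, add_apply]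
  ring

end LieConnection

section Separation

variable {E : Type*} [NormedAddCommGroup E] [NormedSpace ℝ E] [FiniteDimensional ℝ E]
  {H : Type*} [TopologicalSpace H] {I : ModelWithCorners ℝ E H}
  {M : Type*} [TopologicalSpace M] [ChartedSpace H M] [IsManifold I ∞ M] {x : M}

/-- Smooth functions separate tangent vectors. -/
lemma tangent_ext {v w : TangentSpace I x}
    (h : ∀ f : M → ℝ, (∀ᶠ y in 𝓝 x, ContMDiffAt I 𝓘(ℝ, ℝ) ∞ f y) →
      mvfderiv I f x v = mvfderiv I f x w) : v = w := by
  have hinj := (isInvertible_mfderiv_extChartAt (I := I) (mem_extChartAt_source x)).injective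
  apply hinj
  by_contra hne
  obtain ⟨L, hL'⟩ := SeparatingDual.exists_separating_of_ne (R := ℝ) (V := E) hne
  refine hL' ?_
  have hs : ∀ᶠ y in 𝓝 x, ContMDiffAt I 𝓘(ℝ, E) ∞ (extChartAt I x) y := by
    filter_upwards [chart_source_mem_nhds H x] with y hy using contMDiffAt_extChartAt' hy
  have h1 := h (L ∘ extChartAt I x)
    (hs.mono fun y hy => L.contDiff.contMDiff.contMDiffAt.comp y hy)
  have hd : MDifferentiableAt I 𝓘(ℝ, E) (extChartAt I x) x :=
    hs.self_of_nhds.mdifferentiableAt (by simp)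
  have hL : MDifferentiableAt 𝓘(ℝ, E) 𝓘(ℝ, ℝ) L (extChartAt I x x) :=
    L.differentiableAt.mdifferentiableAt
  rw [mvfderiv_comp_apply x hL hd, mvfderiv_comp_apply x hL hd] at h1
  have h2 : mvfderiv 𝓘(ℝ, E) L (extChartAt I x x) = L := by
    simp only [mvfderiv, mfderiv_eq_fderiv]
    rw [ContinuousLinearMap.fderiv]
    rfl
  rw [h2] at h1
  exact h1

end Separation

section Immersed

open VectorField

variable {d : ℕ} {N : Type*} [TopologicalSpace N] [ChartedSpace (E d) N] [IsManifold (𝓡 d) ∞ N]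
  {M : Type*} [TopologicalSpace M] [ChartedSpace (E (d + 1)) M] [IsManifold (𝓡 (d + 1)) ∞ M]
  {φ : N → M} {p : N}

/-- An immersion has a smooth local left inverse. -/
lemma exists_local_left_inverse (h : Manifold.IsImmersionAt (𝓡 d) (𝓡 (d + 1)) ∞ φ p) :
    ∃ ρ : M → N, (∀ᶠ x in 𝓝 (φ p), ContMDiffAt (𝓡 (d + 1)) (𝓡 d) ∞ ρ x) ∧
      ∀ᶠ q in 𝓝 p, ρ (φ q) = q := by
  set c := h.codChart.extend (𝓡 (d + 1))
  set b := h.domChart.extend (𝓡 d)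
  have hb : ∀ q ∈ h.domChart.source, c (φ q) = h.equiv (b q, 0) := by
    intro q hq
    have hq' : q ∈ b.source := by simpa [b] using hq
    have : c (φ (b.symm (b q))) = h.equiv (b q, 0) := h.writtenInCharts (b.map_source hq')
    rwa [b.left_inv hq'] at this
  refine ⟨fun x => b.symm (h.equiv.symm (c x)).1, ?_, ?_⟩
  · have hp : p ∈ b.source := by simpa [b] using h.mem_domChart_source
    have hc : ContMDiffAt (𝓡 (d + 1)) 𝓘(ℝ, E (d + 1)) ∞ c (φ p) :=
      h.codChart.contMDiffAt_extend h.codChart_mem_maximalAtlas h.mem_codChart_source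
    have hlin : ContDiff ℝ ∞ (fun y : E (d + 1) => (h.equiv.symm y).1) :=
      contDiff_fst.comp h.equiv.symm.contDiff
    have hcont : ContinuousAt (fun x => (h.equiv.symm (c x)).1) (φ p) :=
      hlin.continuous.continuousAt.comp hc.continuousAt
    have hval : (h.equiv.symm (c (φ p))).1 = b p := by
      rw [hb p h.mem_domChart_source]; simp
    have htgt : ∀ᶠ x in 𝓝 (φ p), (h.equiv.symm (c x)).1 ∈ b.target := by
      refine hcont.eventually_mem ?_
      simp only [hval]
      exact (h.domChart.isOpen_extend_target).mem_nhds (b.map_source hp)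
    filter_upwards [htgt, h.codChart.open_source.mem_nhds h.mem_codChart_source] with x hx hx'
    have h1 : ContMDiffAt 𝓘(ℝ, E d) (𝓡 d) ∞ b.symm (h.equiv.symm (c x)).1 := by
      have := contMDiffOn_extend_symm h.domChart_mem_maximalAtlas
      rw [← OpenPartialHomeomorph.extend_target'] at this
      exact this.contMDiffAt ((h.domChart.isOpen_extend_target).mem_nhds hx)
    have h2 : ContMDiffAt (𝓡 (d + 1)) 𝓘(ℝ, E d) ∞ (fun x => (h.equiv.symm (c x)).1) x :=
      hlin.contMDiff.contMDiffAt.comp x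
        (h.codChart.contMDiffAt_extend h.codChart_mem_maximalAtlas hx')
    exact ContMDiffAt.comp x h1 h2
  · filter_upwards [h.domChart.open_source.mem_nhds h.mem_domChart_source] with q hq
    rw [hb q hq]
    have hq' : q ∈ b.source := by simpa [b] using hq
    simp [b.left_inv hq']

/-- A smooth vector field along an immersion extends locally to a smooth vector field. -/
lemma exists_extension (h : Manifold.IsImmersionAt (𝓡 d) (𝓡 (d + 1)) ∞ φ p)
    {ζ : ∀ q, TangentSpace (𝓡 (d + 1)) (φ q)}
    (hζ : ∀ᶠ q in 𝓝 p, ContMDiffAt (𝓡 d) (𝓡 (d + 1)).tangent ∞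
      (fun q => (⟨φ q, ζ q⟩ : TangentBundle (𝓡 (d + 1)) M)) q) :
    ∃ Z : VF (𝓡 (d + 1)) M, SmoothNear Z (φ p) ∧ ∀ᶠ q in 𝓝 p, Z (φ q) = ζ q := by
  obtain ⟨ρ, hρ, hρφ⟩ := exists_local_left_inverse h
  set t := trivializationAt (E (d + 1)) (TangentSpace (𝓡 (d + 1)) : M → Type _) (φ p)
  have ht : φ p ∈ t.baseSet := FiberBundle.mem_baseSet_trivializationAt' (φ p)
  have htn : t.baseSet ∈ 𝓝 (φ p) := t.open_baseSet.mem_nhds ht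
  have hφ : ContinuousAt φ p := h.continuousAt
  have hρp : ρ (φ p) = p := hρφ.self_of_nhds
  have hρc : Filter.Tendsto ρ (𝓝 (φ p)) (𝓝 p) := by
    have := hρ.self_of_nhds.continuousAt
    rwa [ContinuousAt, hρp] at this
  refine ⟨fun x => t.symm x (t ⟨φ (ρ x), ζ (ρ x)⟩).2, ?_, ?_⟩
  · filter_upwards [hρ, htn, hρc.eventually hζ, hρc.eventually (hφ.eventually htn)]
      with x hx hxt hxζ hxφ
    refine (t.contMDiffAt_section_iff (n := ∞) (IB := 𝓡 (d + 1)) hxt).2 ?_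
    have h1 := ((t.contMDiffAt_iff (n := ∞) (IB := 𝓡 (d + 1)) (x₀ := ρ x)
      (f := fun q => (⟨φ q, ζ q⟩ : TangentBundle (𝓡 (d + 1)) M)) (t.mem_source.2 hxφ)).1 hxζ).2
    have h2 := h1.comp x hx
    refine h2.congr_of_eventuallyEq ?_
    filter_upwards [t.open_baseSet.mem_nhds hxt] with y hy
    simp [hy]
  · filter_upwards [hρφ, hφ.eventually htn] with q hq hqt
    have key : ∀ r, r = q → t.symm (φ q) (t ⟨φ r, ζ r⟩).2 = ζ q := by
      rintro _ rfl
      rw [t.symm_apply_apply_mk hqt]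
    exact key _ hq

/-- Near `φ p`, the vector field `X'` is smooth and `φ`-related to `X`. -/
def IsLift (φ : N → M) (p : N) (X : VF (𝓡 d) N) (X' : VF (𝓡 (d + 1)) M) : Prop :=
  SmoothNear X' (φ p) ∧ ∀ᶠ q in 𝓝 p, X' (φ q) = push φ q (X q)

variable {X Y : VF (𝓡 d) N} {X' Y' : VF (𝓡 (d + 1)) M}

lemma IsLift.apply (h : IsLift φ p X X') : X' (φ p) = push φ p (X p) := h.2.self_of_nhds

lemma exists_lift (h : Manifold.IsImmersion (𝓡 d) (𝓡 (d + 1)) ∞ φ) (hX : SmoothNear X p) :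
    ∃ X', IsLift φ p X X' := by
  refine exists_extension (h.isImmersionAt p) ?_
  filter_upwards [hX] with q hq
  exact ContMDiffAt.comp q
    ((h.contMDiff.contMDiff_tangentMap (m := ∞) (by simp)).contMDiffAt) hq

lemma dir_push (hφ : ContMDiff (𝓡 d) (𝓡 (d + 1)) ∞ φ) {f : M → ℝ}
    (hf : FDiffAt (𝓡 (d + 1)) f (φ p)) (h : X' (φ p) = push φ p (X p)) :
    dir X' f (φ p) = dir X (f ∘ φ) p := by
  simp only [dir, h]
  exact (mvfderiv_comp_apply p hf (hφ.contMDiffAt.mdifferentiableAt (by simp)) (X p)).symm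

lemma IsLift.dir (hφ : ContMDiff (𝓡 d) (𝓡 (d + 1)) ∞ φ) (h : IsLift φ p X X') {f : M → ℝ}
    {f₀ : N → ℝ} (hf : FDiffAt (𝓡 (d + 1)) f (φ p)) (hff : ∀ᶠ q in 𝓝 p, f (φ q) = f₀ q) :
    dir X' f (φ p) = dir X f₀ p := by
  rw [dir_push hφ hf h.apply]
  exact dir_congr hff

lemma IsLift.bracket_apply (hφ : ContMDiff (𝓡 d) (𝓡 (d + 1)) ∞ φ) (hX : SmoothNear X p)
    (hY : SmoothNear Y p) (h : IsLift φ p X X') (h' : IsLift φ p Y Y') :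
    mlieBracket (𝓡 (d + 1)) X' Y' (φ p) = push φ p (mlieBracket (𝓡 d) X Y p) := by
  refine tangent_ext fun f hf => ?_
  have hfφ : ∀ᶠ q in 𝓝 p, ContMDiffAt (𝓡 d) 𝓘(ℝ, ℝ) ∞ (f ∘ φ) q := by
    filter_upwards [hφ.continuous.continuousAt.eventually hf] with q hq
    exact hq.comp q hφ.contMDiffAt
  have key : ∀ {A : VF (𝓡 d) N} {A' : VF (𝓡 (d + 1)) M}, IsLift φ p A A' →
      ∀ᶠ q in 𝓝 p, NullHyp.dir A' f (φ q) = NullHyp.dir A (f ∘ φ) q := by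
    intro A A' hA
    filter_upwards [hA.2, hφ.continuous.continuousAt.eventually hf] with q h1 h2
    exact dir_push hφ (h2.mdifferentiableAt (by simp)) h1
  have h1 := dir_bracket h.1 h'.1 hf
  have h2 := dir_bracket hX hY hfφ
  have e1 := h.dir hφ ((h'.1.smoothAt.dir hf.self_of_nhds).mdifferentiableAt (by simp)) (key h')
  have e2 := h'.dir hφ ((h.1.smoothAt.dir hf.self_of_nhds).mdifferentiableAt (by simp)) (key h)
  rw [e1, e2, ← h2] at h1
  have h3 := mvfderiv_comp_apply p (hf.self_of_nhds.mdifferentiableAt (by simp))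
    (hφ.contMDiffAt.mdifferentiableAt (by simp)) (mlieBracket (𝓡 d) X Y p)
  exact h1.trans h3

/-- The pull-back of a Lie derivative along a tangent vector field is the Lie derivative of the
pull-back. -/
lemma IsLift.lie2 (hφ : ContMDiff (𝓡 d) (𝓡 (d + 1)) ∞ φ) {T : BilinField (𝓡 (d + 1)) M}
    {t : BilinField (𝓡 d) N} (hT : BilinDiffAt T (φ p))
    (hTt : ∀ᶠ q in 𝓝 p, ∀ v w, T (φ q) (push φ q v) (push φ q w) = t q v w)
    {W : VF (𝓡 d) N} {W' : VF (𝓡 (d + 1)) M}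
    (hX : SmoothNear X p) (hY : SmoothNear Y p) (hW : SmoothNear W p)
    (h : IsLift φ p X X') (h' : IsLift φ p Y Y') (h'' : IsLift φ p W W') :
    lie2 X' (op2 T) Y' W' (φ p) = lie2 X (op2 t) Y W p := by
  have e1 : NullHyp.dir X' (op2 T Y' W') (φ p) = NullHyp.dir X (op2 t Y W) p := by
    refine h.dir hφ (hT _ _ h'.1.diffAt h''.1.diffAt) ?_
    filter_upwards [h'.2, h''.2, hTt] with q h1 h2 h3
    simp only [op2, h1, h2, h3]
  simp only [NullHyp.lie2, e1]
  simp only [op2, h.bracket_apply hφ hX hY h', h.bracket_apply hφ hX hW h'', h'.apply, h''.apply,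
    hTt.self_of_nhds]

end Immersed

open VectorField

lemma contDiff_det (k : ℕ) :
    ContDiff ℝ ∞ (fun A : Fin k → Fin k → ℝ => Matrix.det (Matrix.of A)) := by
  simp only [Matrix.det_apply, Matrix.of_apply]
  refine ContDiff.sum fun σ _ => ContDiff.const_smul _ ?_
  exact contDiff_prod fun i _ => contDiff_apply_apply ℝ ℝ _ _

lemma contMDiffAt_det {E : Type*} [NormedAddCommGroup E] [NormedSpace ℝ E]
    {H : Type*} [TopologicalSpace H] {I : ModelWithCorners ℝ E H}
    {M : Type*} [TopologicalSpace M] [ChartedSpace H M] {k : ℕ} {A : M → Matrix (Fin k) (Fin k) ℝ}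
    {x : M} (hA : ∀ i j, ContMDiffAt I 𝓘(ℝ, ℝ) ∞ (fun y => A y i j) x) :
    ContMDiffAt I 𝓘(ℝ, ℝ) ∞ (fun y => (A y).det) x := by
  have h1 : ContMDiffAt I 𝓘(ℝ, Fin k → Fin k → ℝ) ∞ (fun y i j => A y i j) x :=
    contMDiffAt_pi_space.2 fun i => contMDiffAt_pi_space.2 fun j => hA i j
  exact (contDiff_det k).contMDiff.contMDiffAt.comp x h1

namespace NullData

variable {d : ℕ} {N : Type*} [TopologicalSpace N] [ChartedSpace (E d) N] [IsManifold (𝓡 d) ∞ N]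
  (S : NullData d N)

lemma ambientForm_sharp (p : N) (L : Module.Dual ℝ (TangentSpace (𝓡 d) p × ℝ))
    (y : TangentSpace (𝓡 d) p × ℝ) :
    ambientForm (S.γ p) (S.ℓ p) (S.l2 p) (S.sharp p L) y = L y := by
  have : FiniteDimensional ℝ (TangentSpace (𝓡 d) p) :=
    inferInstanceAs (FiniteDimensional ℝ (E d))
  exact LinearMap.BilinForm.apply_toDual_symm_apply (hB := S.nondeg p) L y

lemma sharp_spec (p : N) (L : Module.Dual ℝ (TangentSpace (𝓡 d) p × ℝ))
    (w : TangentSpace (𝓡 d) p) (b : ℝ) :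
    S.γ p (S.sharp p L).1 w + (S.sharp p L).2 * S.ℓ p w + b * S.ℓ p (S.sharp p L).1
      + (S.sharp p L).2 * b * S.l2 p = L (w, b) :=
  S.ambientForm_sharp p L (w, b)

lemma eq_zero_of_ambientForm {p : N} {v : TangentSpace (𝓡 d) p} {a : ℝ}
    (h1 : ∀ w, S.γ p v w + a * S.ℓ p w = 0) (h2 : S.ℓ p v + a * S.l2 p = 0) : v = 0 ∧ a = 0 := by
  have h := (S.nondeg p).1 (v, a) (by
    rintro ⟨w, b⟩
    change S.γ p v w + a * S.ℓ p w + b * S.ℓ p v + a * b * S.l2 p = 0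
    linear_combination h1 w + b * h2)
  exact ⟨congrArg Prod.fst h, congrArg Prod.snd h⟩

lemma sharp_snd_snd (p : N) : (S.sharp p (LinearMap.snd ℝ _ ℝ)).2 = 0 := by
  obtain ⟨⟨r, hr⟩, hr0, -⟩ := finrank_eq_one_iff'.1 (S.γ_radical p)
  have hr1 : ∀ w, S.γ p r w = 0 := fun w => by
    have : S.γ p r = 0 := hr
    rw [this]; rfl
  have h := S.sharp_spec p (LinearMap.snd ℝ _ ℝ) r 0
  rw [S.γ_symm, hr1] at h
  simp only [LinearMap.snd_apply, zero_mul, mul_zero, add_zero, zero_add] at h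
  refine (mul_eq_zero.1 h).resolve_right fun h0 => hr0 ?_
  have := (S.eq_zero_of_ambientForm (v := r) (a := 0) (by simp [hr1]) (by simp [h0])).1
  exact Subtype.ext this

lemma γ_n (p : N) (w : TangentSpace (𝓡 d) p) : S.γ p (S.n p) w = 0 := by
  have h := S.sharp_spec p (LinearMap.snd ℝ _ ℝ) w 0
  rw [S.sharp_snd_snd p] at h
  unfold n
  simpa using h

lemma ℓ_n (p : N) : S.ℓ p (S.n p) = 1 := by
  have h := S.sharp_spec p (LinearMap.snd ℝ _ ℝ) 0 1
  rw [S.sharp_snd_snd p] at h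
  unfold n
  simpa using h

/-- The contraction `P(Q, ·)` of a covector. -/
def contractP (p : N) (Q : Module.Dual ℝ (TangentSpace (𝓡 d) p)) : TangentSpace (𝓡 d) p :=
  (S.sharp p (Q ∘ₗ LinearMap.fst ℝ _ ℝ)).1

lemma sharp_fst_snd (p : N) (Q : Module.Dual ℝ (TangentSpace (𝓡 d) p)) :
    (S.sharp p (Q ∘ₗ LinearMap.fst ℝ _ ℝ)).2 = Q (S.n p) := by
  have h := S.sharp_spec p (Q ∘ₗ LinearMap.fst ℝ _ ℝ) (S.n p) 0
  rw [S.γ_symm, S.γ_n, S.ℓ_n] at h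
  simpa using h

lemma γ_contractP (p : N) (Q : Module.Dual ℝ (TangentSpace (𝓡 d) p))
    (w : TangentSpace (𝓡 d) p) :
    S.γ p (S.contractP p Q) w = Q w - Q (S.n p) * S.ℓ p w := by
  have h := S.sharp_spec p (Q ∘ₗ LinearMap.fst ℝ _ ℝ) w 0
  rw [S.sharp_fst_snd] at h
  simp only [LinearMap.comp_apply, LinearMap.fst_apply, zero_mul, mul_zero, add_zero] at h
  unfold contractP
  linarith

lemma ℓ_contractP (p : N) (Q : Module.Dual ℝ (TangentSpace (𝓡 d) p)) :
    S.ℓ p (S.contractP p Q) = -(S.l2 p * Q (S.n p)) := by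
  have h := S.sharp_spec p (Q ∘ₗ LinearMap.fst ℝ _ ℝ) 0 1
  rw [S.sharp_fst_snd] at h
  simp only [LinearMap.comp_apply, LinearMap.fst_apply, map_zero, zero_add, mul_zero] at h
  unfold contractP
  linarith

lemma sum_P (p : N) {ι : Type*} [Fintype ι] (b : Module.Basis ι ℝ (TangentSpace (𝓡 d) p))
    (Q : Module.Dual ℝ (TangentSpace (𝓡 d) p)) :
    ∑ c, ∑ f, (S.P p (b.coord c) (b.coord f) * Q (b c)) • b f = S.contractP p Q := by
  have hQ : Q = ∑ c, Q (b c) • b.coord c := by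
    refine b.ext fun i => ?_
    simp
  rw [← b.sum_repr (S.contractP p Q), Finset.sum_comm]
  refine Finset.sum_congr rfl fun f _ => ?_
  rw [← Finset.sum_smul]
  congr 1
  have h2 : S.contractP p Q = ∑ c, Q (b c) • S.contractP p (b.coord c) := by
    have hlin : ∀ θ : Module.Dual ℝ (TangentSpace (𝓡 d) p), S.contractP p θ =
        (LinearMap.fst ℝ _ ℝ ∘ₗ (S.sharp p).toLinearMap ∘ₗ
          LinearMap.lcomp ℝ ℝ (LinearMap.fst ℝ (TangentSpace (𝓡 d) p) ℝ)) θ := fun _ => rfl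
    conv_lhs => rw [hQ]
    simp only [hlin, map_sum, map_smul]
  rw [h2, map_sum, Finset.sum_apply']
  refine Finset.sum_congr rfl fun c _ => ?_
  rw [map_smul]
  simp only [P, contractP, Module.Basis.coord_apply, Finsupp.smul_apply, smul_eq_mul]
  ring

lemma op2_γ_n (X : VF (𝓡 d) N) : op2 S.γ S.n X = fun _ => 0 := by
  ext p; exact S.γ_n p _

lemma bilinSmoothAt_γ (p : N) : BilinSmoothAt S.γ p := bilinSmoothAt_of_contMDiff S.γ_smooth p

lemma bilinDiffAt_γ (p : N) : BilinDiffAt S.γ p := bilinDiffAt_of_contMDiff S.γ_smooth p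

lemma smoothAt_n (p : N) : SmoothAt S.n p := by
  set t := trivializationAt (E d) (TangentSpace (𝓡 d) : N → Type _) p
  have hpt : p ∈ t.baseSet := FiberBundle.mem_baseSet_trivializationAt' p
  have hs := t.isLocalFrameOn_localFrame_baseSet (𝓡 d) ∞ (PiLp.basisFun 2 ℝ (Fin d))
  set s := t.localFrame (PiLp.basisFun 2 ℝ (Fin d))
  let G : N → Matrix (Fin d) (Fin d) ℝ := fun q => Matrix.of fun i j =>
    S.γ q (s i q) (s j q) + S.ℓ q (s i q) * S.ℓ q (s j q)
  let r : N → Fin d → ℝ := fun q i => S.ℓ q (s i q)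
  let c : N → Fin d → ℝ := fun q i => hs.coeff i q (S.n q)
  have hmul : ∀ q ∈ t.baseSet, ∀ (v : Fin d → ℝ) i, (G q).mulVec v i =
      S.γ q (s i q) (∑ j, v j • s j q) + S.ℓ q (s i q) * S.ℓ q (∑ j, v j • s j q) := by
    intro q hq v i
    simp only [Matrix.mulVec, dotProduct, G, Matrix.of_apply, map_sum, map_smul, smul_eq_mul,
      Finset.mul_sum, ← Finset.sum_add_distrib]
    refine Finset.sum_congr rfl fun j _ => ?_
    ring
  have hGc : ∀ q ∈ t.baseSet, (G q).mulVec (c q) = r q := by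
    intro q hq
    ext i
    rw [hmul q hq, ← hs.coeff_sum_eq S.n hq, S.γ_symm, S.γ_n, S.ℓ_n]
    simp [r]
  have hdet : ∀ q ∈ t.baseSet, (G q).det ≠ 0 := by
    intro q hq h0
    obtain ⟨v, hv0, hv⟩ := Matrix.exists_mulVec_eq_zero_iff.2 h0
    set x := ∑ j, v j • s j q with hx
    have h1 : ∀ w, S.γ q w x + S.ℓ q w * S.ℓ q x = 0 := by
      intro w
      rw [← (hs.toBasisAt hq).sum_repr w]
      simp only [map_sum, map_smul, sum_apply, smul_apply, IsLocalFrameOn.toBasisAt_coe,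
        smul_eq_mul, Finset.sum_mul, ← Finset.sum_add_distrib]
      refine Finset.sum_eq_zero fun i _ => ?_
      have := congrFun hv i
      rw [hmul q hq] at this
      simp only [Pi.zero_apply] at this
      linear_combination ((hs.toBasisAt hq).repr w i) * this
    have h2 : S.ℓ q x = 0 := by
      have := h1 (S.n q)
      rw [S.γ_n, S.ℓ_n] at this
      linarith
    have h3 : x = 0 := (S.eq_zero_of_ambientForm (v := x) (a := 0)
      (fun w => by have := h1 w; rw [S.γ_symm, h2] at this; linarith) (by simp [h2])).1
    exact hv0 (funext fun j => Fintype.linearIndependent_iff.1 (hs.linearIndependent hq) v h3 j)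
  have hsm : ∀ i, SmoothAt (s i) p := fun i => hs.contMDiffAt t.open_baseSet hpt i
  have hr : ∀ i, ContMDiffAt (𝓡 d) 𝓘(ℝ, ℝ) ∞ (fun q => r q i) p := fun i =>
    contMDiffAt_op1 S.ℓ_smooth (hsm i)
  have hG : ∀ i j, ContMDiffAt (𝓡 d) 𝓘(ℝ, ℝ) ∞ (fun q => G q i j) p := fun i j =>
    (S.bilinSmoothAt_γ p _ _ (hsm i) (hsm j)).add ((hr i).mul (hr j))
  refine hs.contMDiffAt_of_coeff (fun i => ?_) (t.open_baseSet.mem_nhds hpt)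
  have h1 : ContMDiffAt (𝓡 d) 𝓘(ℝ, ℝ) ∞ (fun q => ((G q).updateCol i (r q)).det) p := by
    refine contMDiffAt_det fun k l => ?_
    simp only [Matrix.updateCol_apply]
    split_ifs
    · exact hr k
    · exact hG k l
  have h2 := (contMDiffAt_det hG)
  have h3 : ContMDiffAt (𝓡 d) 𝓘(ℝ, ℝ) ∞ (fun q => ((G q).det)⁻¹) p :=
    ((contDiffAt_inv ℝ (hdet p hpt)).contMDiffAt).comp p h2
  refine (h1.mul h3).congr_of_eventuallyEq ?_
  filter_upwards [t.open_baseSet.mem_nhds hpt] with q hq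
  change c q i = _
  have h4 : (G q).cramer (r q) = (G q).det • c q := by
    rw [Matrix.cramer_eq_adjugate_mulVec, ← hGc q hq, Matrix.mulVec_mulVec,
      Matrix.adjugate_mul, Matrix.smul_mulVec, Matrix.one_mulVec]
  have h5 := congrFun h4 i
  rw [Matrix.cramer_apply] at h5
  rw [Pi.mul_apply, h5]
  simp only [Pi.smul_apply, smul_eq_mul]
  field_simp [hdet q hq]

lemma smoothNear_n (p : N) : SmoothNear S.n p := Filter.Eventually.of_forall S.smoothAt_n

end NullData

open VectorField

section General

variable {E : Type*} [NormedAddCommGroup E] [NormedSpace ℝ E] [FiniteDimensional ℝ E]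
  {H : Type*} [TopologicalSpace H] {I : ModelWithCorners ℝ E H}
  {M : Type*} [TopologicalSpace M] [ChartedSpace H M] [IsManifold I ∞ M]

lemma torsionFree_of_torsion_eq_zero
    {D : CovariantDerivative I E (TangentSpace I : M → Type _)} (h : D.torsion = 0) :
    TorsionFree D := by
  intro x X Y hX hY
  exact ((CovariantDerivative.torsion_eq_zero_iff D).1 h hX hY).symm

lemma lie2_smul_left {T : BilinField I M} {Z W V : VF I M} {f : M → ℝ} {x : M}
    (hf : FDiffAt I f x) (hZ : DiffAt Z x) :
    lie2 (f • Z) (op2 T) W V x = f x * lie2 Z (op2 T) W V x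
      + dir W f x * T x (Z x) (V x) + dir V f x * T x (W x) (Z x) := by
  simp only [lie2, op2, bracket_smul_left hf hZ, dir_smul_field, map_add, map_neg, map_smul,
    add_apply, neg_apply, smul_apply, smul_eq_mul]
  ring

end General

namespace NullData

variable {d : ℕ} {N : Type*} [TopologicalSpace N] [ChartedSpace (E d) N] [IsManifold (𝓡 d) ∞ N]
  (S : NullData d N) {D₀ : CovariantDerivative (𝓡 d) (E d) (TangentSpace (𝓡 d) : N → Type _)}
  {X W V : VF (𝓡 d) N} {p : N}

lemma U_n_left (W : VF (𝓡 d) N) (p : N) : S.U S.n W p = 0 := by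
  simp only [U, lie2, S.op2_γ_n, dir_const, op2, S.γ_n, mlieBracket_self]
  simp

lemma U_symm (X W : VF (𝓡 d) N) (p : N) : S.U X W p = S.U W X p := by
  have h : op2 S.γ X W = op2 S.γ W X := by ext q; exact S.γ_symm _ _ _
  simp only [U, lie2, h]
  simp only [op2, S.γ_symm p _ (W p), S.γ_symm p (X p)]
  ring

/-- The tensor `U` as a field of bilinear forms. -/
def Uf (D₀ : CovariantDerivative (𝓡 d) (E d) (TangentSpace (𝓡 d) : N → Type _)) :
    BilinField (𝓡 d) N := fun p => (1 / 2 : ℝ) • deformBilin D₀ S.γ S.n p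

variable {S}

lemma IsMetricConn.torsionFree (hD₀ : S.IsMetricConn D₀) : TorsionFree D₀ :=
  torsionFree_of_torsion_eq_zero hD₀.torsion

lemma IsMetricConn.U_eq (hD₀ : S.IsMetricConn D₀) (hX : DiffAt X p) (hW : DiffAt W p) :
    S.U X W p = S.Uf D₀ p (X p) (W p) := by
  have hn := (S.smoothNear_n p).diffAt
  have h := hD₀.cov_γ p S.n X W hn hX hW
  rw [S.U_n_left, S.U_n_left] at h
  have h2 := lie2_eq_deformBilin hD₀.torsionFree hn hX hW (by linarith)
  simp only [U, h2, Uf, op2]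
  rfl

lemma IsMetricConn.Uf_n_left (hD₀ : S.IsMetricConn D₀) (w : TangentSpace (𝓡 d) p) :
    S.Uf D₀ p (S.n p) w = 0 := by
  have h := hD₀.U_eq (S.smoothNear_n p).diffAt (smoothNear_extend w).diffAt
  rw [S.U_n_left, extend_self] at h
  exact h.symm

lemma Uf_symm (v w : TangentSpace (𝓡 d) p) : S.Uf D₀ p v w = S.Uf D₀ p w v := by
  have := deformBilin_symm (D := D₀) (η := S.n) (S.γ_symm p) v w
  simp only [Uf, smul_apply, this]

lemma IsMetricConn.bilinDiffAt_Uf (hD₀ : S.IsMetricConn D₀) (p : N) :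
    BilinDiffAt (S.Uf D₀) p := by
  intro X Y hX hY
  exact (mdifferentiableAt_const (c := (1 / 2 : ℝ))).mul
    (bilinDiffAt_deformBilin hD₀.smooth (S.bilinDiffAt_γ p) (S.smoothNear_n p) X Y hX hY)

lemma IsMetricConn.U_eventuallyEq (hD₀ : S.IsMetricConn D₀) (hX : SmoothNear X p)
    (hW : SmoothNear W p) : S.U X W =ᶠ[𝓝 p] op2 (S.Uf D₀) X W := by
  filter_upwards [hX, hW] with q h1 h2 using hD₀.U_eq h1.diffAt h2.diffAt

lemma IsMetricConn.lie2_U (hD₀ : S.IsMetricConn D₀) (hX : SmoothNear X p) (hW : SmoothNear W p) :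
    lie2 S.n S.U X W p = lie2 S.n (op2 (S.Uf D₀)) X W p := by
  have hn := S.smoothNear_n p
  simp only [lie2, dir_congr (hD₀.U_eventuallyEq hX hW),
    hD₀.U_eq (hn.bracket hX).diffAt hW.diffAt, hD₀.U_eq hX.diffAt (hn.bracket hW).diffAt]
  rfl

lemma IsMetricConn.cov2_U (hD₀ : S.IsMetricConn D₀) (hX : SmoothNear X p) (hW : SmoothNear W p)
    (hV : SmoothNear V p) :
    cov2 D₀ S.U X W V p = cov2 D₀ (op2 (S.Uf D₀)) X W V p := by
  simp only [cov2, dir_congr (hD₀.U_eventuallyEq hW hV),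
    hD₀.U_eq (hX.cov hD₀.smooth hW).diffAt hV.diffAt,
    hD₀.U_eq hW.diffAt (hX.cov hD₀.smooth hV).diffAt]
  rfl

/-- The combination of derivatives of `U` contracted with `n` is `-£_n U`. -/
lemma IsMetricConn.cov2_Uf_n (hD₀ : S.IsMetricConn D₀) (hX : DiffAt X p) (hW : DiffAt W p) :
    cov2 D₀ (op2 (S.Uf D₀)) X W S.n p + cov2 D₀ (op2 (S.Uf D₀)) W X S.n p
      - cov2 D₀ (op2 (S.Uf D₀)) S.n X W p = -lie2 S.n (op2 (S.Uf D₀)) X W p := by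
  have h0 : ∀ A : VF (𝓡 d) N, op2 (S.Uf D₀) A S.n = fun _ => 0 := by
    intro A; ext q
    simp only [op2]
    rw [Uf_symm, hD₀.Uf_n_left]
  have h1 : ∀ v : TangentSpace (𝓡 d) p, S.Uf D₀ p v (S.n p) = 0 := fun v => by
    rw [Uf_symm, hD₀.Uf_n_left]
  rw [cov2_cyclic hD₀.torsionFree Uf_symm hX hW (S.smoothNear_n p).diffAt, h0, h0, dir_const,
    dir_const, h1]
  ring

lemma contMDiffAt_ℓ (hX : SmoothAt X p) : ContMDiffAt (𝓡 d) 𝓘(ℝ, ℝ) ∞ (op1 S.ℓ X) p :=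
  contMDiffAt_op1 S.ℓ_smooth hX

lemma two_mul_s (X : VF (𝓡 d) N) (p : N) :
    2 * S.s X p = dir S.n (op1 S.ℓ X) p - S.ℓ p (mlieBracket (𝓡 d) S.n X p) := by
  have h : op1 S.ℓ S.n = fun _ => 1 := by ext q; exact S.ℓ_n q
  simp only [s, F, ext1, h, dir_const]
  simp only [op1]
  ring

lemma fdiffAt_s (hX : SmoothNear X p) : FDiffAt (𝓡 d) (S.s X) p := by
  have hn := S.smoothNear_n p
  have h1 : FDiffAt (𝓡 d) (dir S.n (op1 S.ℓ X)) p :=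
    (hn.smoothAt.dir (contMDiffAt_ℓ hX.smoothAt)).mdifferentiableAt (by simp)
  have h2 : FDiffAt (𝓡 d) (op1 S.ℓ (mlieBracket (𝓡 d) S.n X)) p :=
    (contMDiffAt_ℓ (hn.bracket hX).smoothAt).mdifferentiableAt (by simp)
  have h3 : S.s X = fun q => (1 / 2 : ℝ) *
      (dir S.n (op1 S.ℓ X) q - op1 S.ℓ (mlieBracket (𝓡 d) S.n X) q) := by
    ext q
    have := two_mul_s (S := S) X q
    simp only [op1] at this ⊢
    linarith
  rw [h3]
  exact (mdifferentiableAt_const (c := (1 / 2 : ℝ))).mul (h1.sub h2)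

lemma s_n (p : N) : S.s S.n p = 0 := by
  have h : op1 S.ℓ S.n = fun _ => 1 := by ext q; exact S.ℓ_n q
  have := two_mul_s (S := S) S.n p
  rw [h, dir_const, mlieBracket_self] at this
  simp at this
  exact this

lemma F_antisymm (X W : VF (𝓡 d) N) (p : N) : S.F X W p = -S.F W X p := by
  simp only [F, ext1, op1, bracket_swap (X := X) (Y := W), map_neg]
  ring

lemma IsMetricConn.ℓ_cov (hD₀ : S.IsMetricConn D₀) (hX : DiffAt X p) (hW : DiffAt W p) :
    S.ℓ p (cov D₀ X W p + cov D₀ W X p) =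
      dir X (op1 S.ℓ W) p + dir W (op1 S.ℓ X) p + 2 * S.l2 p * S.Uf D₀ p (X p) (W p) := by
  have h1 := hD₀.cov_ℓ p X W hX hW
  have h2 := hD₀.cov_ℓ p W X hW hX
  rw [F_antisymm, S.U_symm] at h2
  rw [← hD₀.U_eq hX hW, map_add]
  simp only [cov1] at h1 h2
  change dir X (op1 S.ℓ W) p - S.ℓ p (cov D₀ X W p) = _ at h1
  change dir W (op1 S.ℓ X) p - S.ℓ p (cov D₀ W X p) = _ at h2
  linarith

lemma IsMetricConn.γ_cov (hD₀ : S.IsMetricConn D₀) (hX : DiffAt X p) (hW : DiffAt W p)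
    (hV : DiffAt V p) :
    S.γ p (cov D₀ X W p + cov D₀ W X p) (V p) =
      dir X (op2 S.γ W V) p + dir W (op2 S.γ X V) p - lie2 V (op2 S.γ) X W p
        + 2 * S.ℓ p (V p) * S.Uf D₀ p (X p) (W p) := by
  have h := cov2_cyclic hD₀.torsionFree (S.γ_symm p) hX hW hV
  rw [hD₀.cov_γ p X W V hX hW hV, hD₀.cov_γ p W X V hW hX hV, hD₀.cov_γ p V X W hV hX hW,
    S.U_symm W X, S.U_symm V W, S.U_symm V X, hD₀.U_eq hX hW] at h
  linarith

end NullData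

open VectorField

section Embedding

variable {d : ℕ} {N : Type*} [TopologicalSpace N] [ChartedSpace (E d) N] [IsManifold (𝓡 d) ∞ N]
  {M : Type*} [TopologicalSpace M] [ChartedSpace (E (d + 1)) M] [IsManifold (𝓡 (d + 1)) ∞ M]
  {g : LorentzianMetric d M}
  {D : CovariantDerivative (𝓡 (d + 1)) (E (d + 1)) (TangentSpace (𝓡 (d + 1)) : M → Type _)}
  {S : NullData d N} {φ : N → M} {ζ ν : ∀ p, TangentSpace (𝓡 (d + 1)) (φ p)}
  {D₀ : CovariantDerivative (𝓡 d) (E d) (TangentSpace (𝓡 d) : N → Type _)}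
  {η Z : VF (𝓡 (d + 1)) M} {α : N → ℝ} {X W V : VF (𝓡 d) N} {X' W' V' : VF (𝓡 (d + 1)) M} {p : N}

lemma LorentzianMetric.bilinSmoothAt (g : LorentzianMetric d M) (x : M) :
    BilinSmoothAt g.val x := bilinSmoothAt_of_contMDiff g.contMDiff x

lemma LorentzianMetric.bilinDiffAt (g : LorentzianMetric d M) (x : M) :
    BilinDiffAt g.val x := bilinDiffAt_of_contMDiff g.contMDiff x

lemma IsLeviCivita.torsionFree (hD : IsLeviCivita g D) : TorsionFree D :=
  torsionFree_of_torsion_eq_zero hD.torsion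

lemma IsLeviCivita.compatible (hD : IsLeviCivita g D) : Compatible D g.val := hD.metric

lemma IsLeviCivita.lie2_eq (hD : IsLeviCivita g D) {x : M} {A B : VF (𝓡 (d + 1)) M}
    (hη : DiffAt η x) (hA : DiffAt A x) (hB : DiffAt B x) :
    lie2 η (op2 g.val) A B x = op2 (deformBilin D g.val η) A B x :=
  lie2_eq_deformBilin hD.torsionFree hη hA hB (hD.metric _ _ _ _ hη hA hB)

lemma IsLeviCivita.at2_lie2 (hD : IsLeviCivita g D) {x : M} (hη : DiffAt η x)
    (v w : TangentSpace (𝓡 (d + 1)) x) :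
    at2 (lie2 η (op2 g.val)) x v w = deformBilin D g.val η x v w := by
  rw [at2, hD.lie2_eq hη (smoothNear_extend v).diffAt (smoothNear_extend w).diffAt, op2,
    extend_self, extend_self]

/-- The symmetrized covariant derivative in terms of a Lie derivative of the metric. -/
lemma IsLeviCivita.metric_cov (hD : IsLeviCivita g D) {x : M} {A B C : VF (𝓡 (d + 1)) M}
    (hA : DiffAt A x) (hB : DiffAt B x) (hC : DiffAt C x) :
    g.val x (cov D A B x + cov D B A x) (C x) =
      dir A (op2 g.val B C) x + dir B (op2 g.val A C) x - lie2 C (op2 g.val) A B x := by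
  have h := cov2_cyclic hD.torsionFree (g.symm x) hA hB hC
  rw [hD.metric x A B C hA hB hC, hD.metric x B A C hB hA hC, hD.metric x C A B hC hA hB] at h
  linarith

lemma IsEmbedded.contMDiff (hS : IsEmbedded S g φ ζ) : ContMDiff (𝓡 d) (𝓡 (d + 1)) ∞ φ :=
  hS.embedding.isImmersion.contMDiff

lemma IsEmbedded.exists_lift (hS : IsEmbedded S g φ ζ) (hX : SmoothNear X p) :
    ∃ X', IsLift φ p X X' := NullHyp.exists_lift hS.embedding.isImmersion hX

lemma IsEmbedded.exists_extension (hS : IsEmbedded S g φ ζ) (p : N) :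
    ∃ Z : VF (𝓡 (d + 1)) M, SmoothNear Z (φ p) ∧ ∀ᶠ q in 𝓝 p, Z (φ q) = ζ q :=
  NullHyp.exists_extension (hS.embedding.isImmersion.isImmersionAt p)
    (Filter.Eventually.of_forall hS.rigging.smooth)

lemma IsEmbedded.deformBilin_push (hS : IsEmbedded S g φ ζ) (hD : IsLeviCivita g D)
    (hZ : Extends φ ζ p Z) (v w : TangentSpace (𝓡 d) p) :
    deformBilin D g.val Z (φ p) (push φ p v) (push φ p w) = 2 * S.Y p v w := by
  rw [← hS.Y_eq p Z hZ, hD.at2_lie2 hZ.1.diffAt]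
  ring

/-- A vector at `φ p` is determined by its products with the tangent vectors and the rigging. -/
lemma IsEmbedded.eq_of_products (hS : IsEmbedded S g φ ζ) {x y : TangentSpace (𝓡 (d + 1)) (φ p)}
    (h1 : ∀ v, g.val (φ p) x (push φ p v) = g.val (φ p) y (push φ p v))
    (h2 : g.val (φ p) x (ζ p) = g.val (φ p) y (ζ p)) : x = y := by
  let L : (E d × ℝ) →ₗ[ℝ] E (d + 1) :=
    ((mfderiv (𝓡 d) (𝓡 (d + 1)) φ p).toLinearMap : E d →ₗ[ℝ] E (d + 1)).coprod
      (LinearMap.toSpanSingleton ℝ (E (d + 1)) (ζ p))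
  have hL : ∀ (v : TangentSpace (𝓡 d) p) (a : ℝ),
      L (v, a) = (push φ p v + a • ζ p : TangentSpace (𝓡 (d + 1)) (φ p)) := fun v a => rfl
  have key : ∀ (v : TangentSpace (𝓡 d) p) (a : ℝ),
      (∀ w, g.val (φ p) (push φ p v + a • ζ p) (push φ p w) = 0) →
      g.val (φ p) (push φ p v + a • ζ p) (ζ p) = 0 → v = 0 ∧ a = 0 := by
    intro v a h3 h4
    refine S.eq_zero_of_ambientForm (fun w => ?_) ?_
    · have := h3 w
      simpa only [map_add, map_smul, add_apply, smul_apply, hS.γ_eq, hS.ℓ_eq, smul_eq_mul]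
        using this
    · simpa only [map_add, map_smul, add_apply, smul_apply, g.symm _ (push φ p v), hS.ℓ_eq,
        hS.l2_eq, smul_eq_mul] using h4
  have hinj : Function.Injective L := by
    rw [← LinearMap.ker_eq_bot, LinearMap.ker_eq_bot']
    rintro ⟨v, a⟩ h0
    have h0' : (push φ p v + a • ζ p : TangentSpace (𝓡 (d + 1)) (φ p)) = 0 := h0
    obtain ⟨hv, ha⟩ := key v a (fun w => by rw [h0']; simp) (by rw [h0']; simp)
    exact Prod.ext hv ha
  have hsurj : Function.Surjective L :=
    (LinearMap.injective_iff_surjective_of_finrank_eq_finrank (by simp)).1 hinj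
  obtain ⟨⟨v, a⟩, hva⟩ := hsurj (x - y : TangentSpace (𝓡 (d + 1)) (φ p))
  have hva' : (push φ p v + a • ζ p : TangentSpace (𝓡 (d + 1)) (φ p)) = x - y := hva
  obtain ⟨hv, ha⟩ := key v a (fun w => by rw [hva', map_sub, sub_apply, h1, sub_self])
    (by rw [hva', map_sub, sub_apply, h2, sub_self])
  rw [hv, ha] at hva'
  simp only [map_zero, zero_smul, add_zero] at hva'
  exact sub_eq_zero.1 hva'.symm

lemma IsNormal.eq_push (hν : IsNormal g φ ζ ν) (hS : IsEmbedded S g φ ζ) :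
    ν = fun p => push φ p (S.n p) := by
  ext1 p
  refine hS.eq_of_products (fun v => ?_) ?_
  · rw [hν.tangent, hS.γ_eq, S.γ_n]
  · rw [hν.rigging, g.symm, hS.ℓ_eq, S.ℓ_n]

/-- The Gauss formula, symmetrized. -/
lemma IsEmbedded.gauss (hS : IsEmbedded S g φ ζ) (hD : IsLeviCivita g D)
    (hD₀ : S.IsMetricConn D₀) (hX : SmoothNear X p) (hW : SmoothNear W p)
    (hX' : IsLift φ p X X') (hW' : IsLift φ p W W') :
    cov D X' W' (φ p) + cov D W' X' (φ p) = push φ p (cov D₀ X W p + cov D₀ W X p)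
      - (2 * S.Y p (X p) (W p)) • push φ p (S.n p)
      - (2 * S.Uf D₀ p (X p) (W p)) • ζ p := by
  refine hS.eq_of_products (fun v => ?_) ?_
  · have hV := smoothNear_extend v
    set V : VF (𝓡 d) N := FiberBundle.extend (E d) v
    have hv : V p = v := extend_self v
    obtain ⟨V', hV'⟩ := hS.exists_lift hV
    have hγ : ∀ {A B : VF (𝓡 d) N} {A' B' : VF (𝓡 (d + 1)) M}, IsLift φ p A A' → IsLift φ p B B' →
        ∀ᶠ q in 𝓝 p, op2 g.val A' B' (φ q) = op2 S.γ A B q := by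
      intro A B A' B' hA hB
      filter_upwards [hA.2, hB.2] with q h1 h2
      simp only [op2, h1, h2, hS.γ_eq]
    have h := hD.metric_cov hX'.1.diffAt hW'.1.diffAt hV'.1.diffAt
    rw [hX'.dir hS.contMDiff (g.bilinDiffAt _ _ _ hW'.1.diffAt hV'.1.diffAt) (hγ hW' hV'),
      hW'.dir hS.contMDiff (g.bilinDiffAt _ _ _ hX'.1.diffAt hV'.1.diffAt) (hγ hX' hV'),
      hV'.lie2 hS.contMDiff (g.bilinDiffAt _) (Filter.Eventually.of_forall hS.γ_eq) hV hX hW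
        hX' hW', hV'.apply, hv] at h
    have h0 := hD₀.γ_cov hX.diffAt hW.diffAt hV.diffAt
    rw [hv] at h0
    rw [h, map_sub, map_sub, sub_apply, sub_apply, map_smul, map_smul, smul_apply, smul_apply,
      hS.γ_eq, hS.γ_eq, hS.ℓ_eq, S.γ_n, h0]
    simp only [smul_eq_mul]
    ring
  · obtain ⟨Z, hZ, hZζ⟩ := hS.exists_extension p
    have hZp : Z (φ p) = ζ p := hZζ.self_of_nhds
    have hℓ : ∀ {A : VF (𝓡 d) N} {A' : VF (𝓡 (d + 1)) M}, IsLift φ p A A' →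
        ∀ᶠ q in 𝓝 p, op2 g.val A' Z (φ q) = op1 S.ℓ A q := by
      intro A A' hA
      filter_upwards [hA.2, hZζ] with q h1 h2
      simp only [op2, op1, h1, h2, g.symm _ (push φ q _), hS.ℓ_eq]
    have h := hD.metric_cov hX'.1.diffAt hW'.1.diffAt hZ.diffAt
    rw [hX'.dir hS.contMDiff (g.bilinDiffAt _ _ _ hW'.1.diffAt hZ.diffAt) (hℓ hW'),
      hW'.dir hS.contMDiff (g.bilinDiffAt _ _ _ hX'.1.diffAt hZ.diffAt) (hℓ hX'),
      hD.lie2_eq hZ.diffAt hX'.1.diffAt hW'.1.diffAt, op2, hX'.apply, hW'.apply,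
      hS.deformBilin_push hD ⟨hZ.smoothAt, hZζ⟩, hZp] at h
    have h0 := hD₀.ℓ_cov hX.diffAt hW.diffAt
    rw [h, map_sub, map_sub, sub_apply, sub_apply, map_smul, map_smul, smul_apply, smul_apply,
      g.symm _ (push φ p _), g.symm _ (push φ p _), hS.ℓ_eq, hS.ℓ_eq, hS.l2_eq, S.ℓ_n, h0]
    simp only [smul_eq_mul]
    ring

end Embedding

open VectorField

section Deformation

variable {d : ℕ} {N : Type*} [TopologicalSpace N] [ChartedSpace (E d) N] [IsManifold (𝓡 d) ∞ N]
  {M : Type*} [TopologicalSpace M] [ChartedSpace (E (d + 1)) M] [IsManifold (𝓡 (d + 1)) ∞ M]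
  {g : LorentzianMetric d M}
  {D : CovariantDerivative (𝓡 (d + 1)) (E (d + 1)) (TangentSpace (𝓡 (d + 1)) : M → Type _)}
  {S : NullData d N} {φ : N → M} {ζ : ∀ p, TangentSpace (𝓡 (d + 1)) (φ p)}
  {D₀ : CovariantDerivative (𝓡 d) (E d) (TangentSpace (𝓡 d) : N → Type _)}
  {η Z : VF (𝓡 (d + 1)) M} {α : N → ℝ} {X W V : VF (𝓡 d) N} {X' W' V' : VF (𝓡 (d + 1)) M} {p : N}

lemma push_add (v w : TangentSpace (𝓡 d) p) : push φ p (v + w) = push φ p v + push φ p w :=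
  map_add (mfderiv (𝓡 d) (𝓡 (d + 1)) φ p) v w

lemma push_smul (c : ℝ) (v : TangentSpace (𝓡 d) p) : push φ p (c • v) = c • push φ p v :=
  map_smul (mfderiv (𝓡 d) (𝓡 (d + 1)) φ p) c v

lemma IsLeviCivita.lie2_lie2_eq (hD : IsLeviCivita g D) {x : M} {A B : VF (𝓡 (d + 1)) M}
    (hZ : SmoothAt Z x) (hη : SmoothNear η x) (hA : SmoothNear A x) (hB : SmoothNear B x) :
    lie2 Z (lie2 η (op2 g.val)) A B x = lie2 Z (op2 (deformBilin D g.val η)) A B x := by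
  have h1 : lie2 η (op2 g.val) A B =ᶠ[𝓝 x] op2 (deformBilin D g.val η) A B := by
    filter_upwards [hη, hA, hB] with y h1 h2 h3 using hD.lie2_eq h1.diffAt h2.diffAt h3.diffAt
  have h2 := hD.lie2_eq hη.diffAt (hZ.bracket hA.smoothAt).diffAt hB.diffAt
  have h3 := hD.lie2_eq hη.diffAt hA.diffAt (hZ.bracket hB.smoothAt).diffAt
  change dir Z (lie2 η (op2 g.val) A B) x - lie2 η (op2 g.val) (mlieBracket (𝓡 (d + 1)) Z A) B x
    - lie2 η (op2 g.val) A (mlieBracket (𝓡 (d + 1)) Z B) x = _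
  rw [dir_congr h1, h2, h3]
  rfl

/-- Embedded null hypersurface data together with a smooth vector field `η` whose restriction to the
hypersurface is `α n`. -/
structure TangentDeformation (g : LorentzianMetric d M)
    (D : CovariantDerivative (𝓡 (d + 1)) (E (d + 1)) (TangentSpace (𝓡 (d + 1)) : M → Type _))
    (S : NullData d N) (φ : N → M) (ζ : ∀ p, TangentSpace (𝓡 (d + 1)) (φ p))
    (D₀ : CovariantDerivative (𝓡 d) (E d) (TangentSpace (𝓡 d) : N → Type _))
    (η : VF (𝓡 (d + 1)) M) (α : N → ℝ) : Prop where
  leviCivita : IsLeviCivita g D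
  embedded : IsEmbedded S g φ ζ
  metricConn : S.IsMetricConn D₀
  smooth : ∀ p, SmoothNear η (φ p)
  tangent : ∀ p, η (φ p) = α p • push φ p (S.n p)

namespace TangentDeformation

lemma contMDiffAt_α (h : TangentDeformation g D S φ ζ D₀ η α) (p : N) :
    ContMDiffAt (𝓡 d) 𝓘(ℝ, ℝ) ∞ α p := by
  obtain ⟨Z, hZ, hZζ⟩ := h.embedded.exists_extension p
  refine ContMDiffAt.congr_of_eventuallyEq (f := op2 g.val η Z ∘ φ) ?_ ?_
  · exact (g.bilinSmoothAt _ _ _ (h.smooth p).smoothAt hZ.smoothAt).comp p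
      h.embedded.contMDiff.contMDiffAt
  · filter_upwards [hZζ] with q hq
    simp only [Function.comp, op2, hq, h.tangent, map_smul, smul_apply, g.symm _ (push φ q _),
      h.embedded.ℓ_eq, S.ℓ_n, smul_eq_mul, mul_one]

lemma fdiffAt_α (h : TangentDeformation g D S φ ζ D₀ η α) (p : N) : FDiffAt (𝓡 d) α p :=
  (h.contMDiffAt_α p).mdifferentiableAt (by simp)

lemma fdiffAt_dir_α (h : TangentDeformation g D S φ ζ D₀ η α) (hX : SmoothNear X p) :
    FDiffAt (𝓡 d) (dir X α) p :=
  (hX.smoothAt.dir (h.contMDiffAt_α p)).mdifferentiableAt (by simp)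

lemma smoothNear_smul_n (h : TangentDeformation g D S φ ζ D₀ η α) (p : N) :
    SmoothNear (α • S.n) p :=
  Filter.Eventually.of_forall fun q => (S.smoothAt_n q).smul (h.contMDiffAt_α q)

lemma isLift (h : TangentDeformation g D S φ ζ D₀ η α) (p : N) :
    IsLift φ p (α • S.n) η := by
  refine ⟨h.smooth p, Filter.Eventually.of_forall fun q => ?_⟩
  rw [h.tangent, Pi.smul_apply', push_smul]

/-- The pull-back of `£_η g` is `2 α U`. -/
lemma deform_push_push (h : TangentDeformation g D S φ ζ D₀ η α) (p : N)
    (v w : TangentSpace (𝓡 d) p) :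
    deformBilin D g.val η (φ p) (push φ p v) (push φ p w) = 2 * α p * S.Uf D₀ p v w := by
  have hX := smoothNear_extend v
  have hW := smoothNear_extend w
  set X : VF (𝓡 d) N := FiberBundle.extend (E d) v
  set W : VF (𝓡 d) N := FiberBundle.extend (E d) w
  have hv : X p = v := extend_self v
  have hw : W p = w := extend_self w
  obtain ⟨X', hX'⟩ := h.embedded.exists_lift hX
  obtain ⟨W', hW'⟩ := h.embedded.exists_lift hW
  have h1 := (h.isLift p).lie2 h.embedded.contMDiff (g.bilinDiffAt _)
    (Filter.Eventually.of_forall h.embedded.γ_eq) (h.smoothNear_smul_n p) hX hW hX' hW'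
  have h2 := h.metricConn.U_eq hX.diffAt hW.diffAt
  rw [h.leviCivita.lie2_eq (h.smooth p).diffAt hX'.1.diffAt hW'.1.diffAt, op2, hX'.apply,
    hW'.apply, lie2_smul_left (h.fdiffAt_α p) (S.smoothAt_n p).diffAt, S.γ_symm p (X p), S.γ_n,
    S.γ_n] at h1
  rw [hv, hw] at h1 h2
  rw [h1, ← h2, NullData.U]
  ring

lemma bilinDiffAt_deform (h : TangentDeformation g D S φ ζ D₀ η α) (p : N) :
    BilinDiffAt (deformBilin D g.val η) (φ p) :=
  bilinDiffAt_deformBilin h.leviCivita.smooth (g.bilinDiffAt _) (h.smooth p)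

lemma pScal_eq (h : TangentDeformation g D S φ ζ D₀ η α) (p : N) :
    pScal g φ ζ η p = deformBilin D g.val η (φ p) (ζ p) (ζ p) :=
  h.leviCivita.at2_lie2 (h.smooth p).diffAt _ _

lemma wScal_eq (h : TangentDeformation g D S φ ζ D₀ η α)
    (ν : ∀ p, TangentSpace (𝓡 (d + 1)) (φ p)) (p : N) :
    wScal g φ ζ η ν p = deformBilin D g.val η (φ p) (ζ p) (ν p) :=
  h.leviCivita.at2_lie2 (h.smooth p).diffAt _ _

lemma qForm_eq (h : TangentDeformation g D S φ ζ D₀ η α) (X : VF (𝓡 d) N) (p : N) :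
    qForm g φ ζ η X p = deformBilin D g.val η (φ p) (ζ p) (push φ p (X p)) :=
  h.leviCivita.at2_lie2 (h.smooth p).diffAt _ _

lemma deform_symm (x : M) (v w : TangentSpace (𝓡 (d + 1)) x) :
    deformBilin D g.val η x v w = deformBilin D g.val η x w v :=
  deformBilin_symm (g.symm x) v w

lemma fdiffAt_qForm (h : TangentDeformation g D S φ ζ D₀ η α) (hX : SmoothNear X p) :
    FDiffAt (𝓡 d) (qForm g φ ζ η X) p := by
  obtain ⟨Z, hZ, hZζ⟩ := h.embedded.exists_extension p
  obtain ⟨X', hX'⟩ := h.embedded.exists_lift hX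
  have h1 : FDiffAt (𝓡 d) (op2 (deformBilin D g.val η) Z X' ∘ φ) p :=
    MDifferentiableAt.comp p (h.bilinDiffAt_deform p _ _ hZ.diffAt hX'.1.diffAt)
      (h.embedded.contMDiff.contMDiffAt.mdifferentiableAt (by simp))
  refine h1.congr_of_eventuallyEq ?_
  filter_upwards [hZζ, hX'.2] with q h1 h2
  simp only [h.qForm_eq, Function.comp, op2, h1, h2]

/-- The product of `Σ` with an arbitrary vector field. -/
lemma two_mul_sigma (h : TangentDeformation g D S φ ζ D₀ η α) (hX' : IsLift φ p X X')
    (hW' : IsLift φ p W W') (hV : DiffAt V' (φ p)) :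
    2 * g.val (φ p) (sigma φ η D X W p) (V' (φ p)) =
      dir X' (op2 (deformBilin D g.val η) W' V') (φ p)
        + dir W' (op2 (deformBilin D g.val η) X' V') (φ p)
        - lie2 V' (op2 (deformBilin D g.val η)) X' W' (φ p)
        - deformBilin D g.val η (φ p) (cov D X' W' (φ p) + cov D W' X' (φ p)) (V' (φ p)) := by
  have hD := h.leviCivita
  have hK := h.bilinDiffAt_deform p
  have e1 := smoothNear_extend (push φ p (X p))
  have e2 := smoothNear_extend (push φ p (W p))
  have e3 := smoothNear_extend (V' (φ p))
  have x1 := (extend_self (push φ p (X p))).trans hX'.apply.symm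
  have x2 := (extend_self (push φ p (W p))).trans hW'.apply.symm
  have x3 := extend_self (V' (φ p))
  have h1 := two_mul_lieConn hD.smooth hD.torsionFree g.bilinSmoothAt g.symm hD.compatible
    (h.smooth p) e1 e2 e3
  rw [cov2_congr_values hK e2.diffAt hW'.1.diffAt e3.diffAt hV x1 x2 x3,
    cov2_congr_values hK e1.diffAt hX'.1.diffAt e3.diffAt hV x2 x1 x3,
    cov2_congr_values hK e1.diffAt hX'.1.diffAt e2.diffAt hW'.1.diffAt x3 x1 x2,
    cov2_cyclic hD.torsionFree (deform_symm _) hX'.1.diffAt hW'.1.diffAt hV, x3] at h1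
  exact h1

/-- The products of `Σ` with tangent vectors. -/
lemma sigma_push (h : TangentDeformation g D S φ ζ D₀ η α) (hX : SmoothNear X p)
    (hW : SmoothNear W p) (hV : SmoothNear V p) :
    g.val (φ p) (sigma φ η D X W p) (push φ p (V p)) =
      (dir X α p * S.Uf D₀ p (W p) (V p) + dir W α p * S.Uf D₀ p (X p) (V p))
        + S.Uf D₀ p (X p) (W p) * (qForm g φ ζ η V p - dir V α p)
        + α p * (cov2 D₀ (op2 (S.Uf D₀)) X W V p + cov2 D₀ (op2 (S.Uf D₀)) W X V p
          - cov2 D₀ (op2 (S.Uf D₀)) V X W p) := by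
  obtain ⟨X', hX'⟩ := h.embedded.exists_lift hX
  obtain ⟨W', hW'⟩ := h.embedded.exists_lift hW
  obtain ⟨V', hV'⟩ := h.embedded.exists_lift hV
  have hK := h.bilinDiffAt_deform p
  have hU := h.metricConn.bilinDiffAt_Uf p
  have hα := h.fdiffAt_α p
  let t : BilinField (𝓡 d) N := fun q => (2 * α q) • S.Uf D₀ q
  have ht : ∀ A B : VF (𝓡 d) N, op2 t A B = fun q => 2 * (α q * op2 (S.Uf D₀) A B q) := by
    intro A B; ext q
    simp only [t, op2, smul_apply, smul_eq_mul]
    ring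
  have hdir : ∀ {A B C : VF (𝓡 d) N}, DiffAt B p → DiffAt C p → dir A (op2 t B C) p =
      2 * (α p * dir A (op2 (S.Uf D₀) B C) p + S.Uf D₀ p (B p) (C p) * dir A α p) := by
    intro A B C hB hC
    have hm : FDiffAt (𝓡 d) (fun q => α q * op2 (S.Uf D₀) B C q) p := hα.mul (hU _ _ hB hC)
    rw [ht, dir_const_mul _ hm, dir_mul hα (hU _ _ hB hC)]
    rfl
  have hKt : ∀ᶠ q in 𝓝 p, ∀ v w, deformBilin D g.val η (φ q) (push φ q v) (push φ q w) = t q v w :=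
    Filter.Eventually.of_forall fun q v w => h.deform_push_push q v w
  have hop : ∀ {A B : VF (𝓡 d) N} {A' B' : VF (𝓡 (d + 1)) M}, IsLift φ p A A' → IsLift φ p B B' →
      ∀ᶠ q in 𝓝 p, op2 (deformBilin D g.val η) A' B' (φ q) = op2 t A B q := by
    intro A B A' B' hA hB
    filter_upwards [hA.2, hB.2, hKt] with q h1 h2 h3
    simp only [op2, h1, h2, h3]
  have h1 := h.two_mul_sigma hX' hW' hV'.1.diffAt
  rw [hX'.dir h.embedded.contMDiff (hK _ _ hW'.1.diffAt hV'.1.diffAt) (hop hW' hV'),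
    hW'.dir h.embedded.contMDiff (hK _ _ hX'.1.diffAt hV'.1.diffAt) (hop hX' hV'),
    hV'.lie2 h.embedded.contMDiff hK hKt hV hX hW hX' hW', hV'.apply,
    h.embedded.gauss h.leviCivita h.metricConn hX hW hX' hW', hdir hW.diffAt hV.diffAt,
    hdir hX.diffAt hV.diffAt, map_sub, map_sub, map_smul, map_smul, sub_apply, sub_apply,
    smul_apply, smul_apply, h.deform_push_push, h.deform_push_push, h.metricConn.Uf_n_left,
    ← h.qForm_eq] at h1
  have h2 : lie2 V (op2 t) X W p = 2 * (α p * lie2 V (op2 (S.Uf D₀)) X W p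
      + S.Uf D₀ p (X p) (W p) * dir V α p) := by
    simp only [lie2, hdir hX.diffAt hW.diffAt]
    simp only [ht]
    simp only [op2]
    ring
  rw [h2] at h1
  rw [cov2_cyclic h.metricConn.torsionFree NullData.Uf_symm hX.diffAt hW.diffAt hV.diffAt]
  simp only [smul_eq_mul] at h1
  linarith

lemma dir_qForm (h : TangentDeformation g D S φ ζ D₀ η α) (hX' : IsLift φ p X X')
    (hW' : IsLift φ p W W') (hZ : Extends φ ζ p Z) :
    dir X' (op2 (deformBilin D g.val η) W' Z) (φ p) = dir X (qForm g φ ζ η W) p := by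
  refine hX'.dir h.embedded.contMDiff
    (h.bilinDiffAt_deform p _ _ hW'.1.diffAt hZ.1.diffAt) ?_
  filter_upwards [hW'.2, hZ.2] with q h1 h2
  simp only [op2, h1, h2, deform_symm _ (push φ q _), h.qForm_eq]

lemma iTensor_eq (h : TangentDeformation g D S φ ζ D₀ η α) (hX' : IsLift φ p X X')
    (hW' : IsLift φ p W W') (hZ : Extends φ ζ p Z) :
    2 * iTensor g φ η Z X W p = lie2 Z (op2 (deformBilin D g.val η)) X' W' (φ p) := by
  have e1 := smoothNear_extend (push φ p (X p))
  have e2 := smoothNear_extend (push φ p (W p))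
  have x1 := (extend_self (push φ p (X p))).trans hX'.apply.symm
  have x2 := (extend_self (push φ p (W p))).trans hW'.apply.symm
  rw [← lie2_congr_values h.leviCivita.torsionFree (h.bilinDiffAt_deform p) hZ.1.diffAt
    e1.diffAt hX'.1.diffAt e2.diffAt hW'.1.diffAt x1 x2,
    ← h.leviCivita.lie2_lie2_eq hZ.1 (h.smooth p) e1 e2, iTensor, at2, deform]
  ring

/-- The product of `Σ` with the rigging is `𝔅`. -/
lemma sigma_rigging (h : TangentDeformation g D S φ ζ D₀ η α) (hX : SmoothNear X p)
    (hW : SmoothNear W p) (hZ : Extends φ ζ p Z) :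
    g.val (φ p) (sigma φ η D X W p) (ζ p) =
      bTensor g φ ζ η S D₀ (fun q => push φ q (S.n q)) Z X W p := by
  obtain ⟨X', hX'⟩ := h.embedded.exists_lift hX
  obtain ⟨W', hW'⟩ := h.embedded.exists_lift hW
  have hZp : Z (φ p) = ζ p := hZ.2.self_of_nhds
  have h1 := h.two_mul_sigma hX' hW' hZ.1.diffAt
  rw [h.dir_qForm hX' hW' hZ, h.dir_qForm hW' hX' hZ, ← h.iTensor_eq hX' hW' hZ, hZp,
    h.embedded.gauss h.leviCivita h.metricConn hX hW hX' hW', deform_symm, map_sub, map_sub,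
    map_smul, map_smul, push_add, map_add, ← h.pScal_eq] at h1
  have h2 := h.wScal_eq (fun q => push φ q (S.n q)) p
  rw [← h2] at h1
  simp only [bTensor, cov1, h.metricConn.U_eq hX.diffAt hW.diffAt, op2]
  rw [h.qForm_eq (cov D₀ X W), h.qForm_eq (cov D₀ W X)]
  simp only [smul_eq_mul] at h1
  linarith

end TangentDeformation

end Deformation

open VectorField

section RiggingBracket

variable {d : ℕ} {N : Type*} [TopologicalSpace N] [ChartedSpace (E d) N] [IsManifold (𝓡 d) ∞ N]
  {M : Type*} [TopologicalSpace M] [ChartedSpace (E (d + 1)) M] [IsManifold (𝓡 (d + 1)) ∞ M]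
  {g : LorentzianMetric d M}
  {D : CovariantDerivative (𝓡 (d + 1)) (E (d + 1)) (TangentSpace (𝓡 (d + 1)) : M → Type _)}
  {S : NullData d N} {φ : N → M} {ζ : ∀ p, TangentSpace (𝓡 (d + 1)) (φ p)}
  {D₀ : CovariantDerivative (𝓡 d) (E d) (TangentSpace (𝓡 d) : N → Type _)}
  {η Z : VF (𝓡 (d + 1)) M} {α : N → ℝ} {X W V : VF (𝓡 d) N} {X' W' V' : VF (𝓡 (d + 1)) M} {p : N}

namespace TangentDeformation

lemma metric_bracket_push (h : TangentDeformation g D S φ ζ D₀ η α) (hZ : Extends φ ζ p Z)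
    (hW : SmoothNear W p) :
    g.val (φ p) (mlieBracket (𝓡 (d + 1)) Z η (φ p)) (push φ p (W p)) =
      qForm g φ ζ η W p - 2 * α p * S.s W p - dir W α p := by
  obtain ⟨W', hW'⟩ := h.embedded.exists_lift hW
  have hZp : Z (φ p) = ζ p := hZ.2.self_of_nhds
  have h1 := h.leviCivita.lie2_eq (h.smooth p).diffAt hZ.1.diffAt hW'.1.diffAt
  have h2 : dir η (op2 g.val Z W') (φ p) = dir (α • S.n) (op1 S.ℓ W) p := by
    refine (h.isLift p).dir h.embedded.contMDiff
      (g.bilinDiffAt _ _ _ hZ.1.diffAt hW'.1.diffAt) ?_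
    filter_upwards [hZ.2, hW'.2] with q h1 h2
    simp only [op2, op1, h1, h2, h.embedded.ℓ_eq]
  rw [lie2, h2, dir_smul_field] at h1
  simp only [op2] at h1
  rw [(h.isLift p).bracket_apply h.embedded.contMDiff (h.smoothNear_smul_n p) hW hW',
    bracket_swap, hZp, hW'.apply, ← h.qForm_eq, h.embedded.ℓ_eq,
    bracket_smul_left (h.fdiffAt_α p) (S.smoothAt_n p).diffAt, map_add, map_smul, map_neg,
    map_neg, map_smul, S.ℓ_n, neg_apply] at h1
  simp only [smul_eq_mul] at h1
  linear_combination h1 + α p * NullData.two_mul_s (S := S) W p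

lemma metric_bracket_rigging (h : TangentDeformation g D S φ ζ D₀ η α) (hZ : Extends φ ζ p Z) :
    2 * g.val (φ p) (mlieBracket (𝓡 (d + 1)) Z η (φ p)) (ζ p) =
      pScal g φ ζ η p - α p * dir S.n S.l2 p := by
  have hZp : Z (φ p) = ζ p := hZ.2.self_of_nhds
  have h1 := h.leviCivita.lie2_eq (h.smooth p).diffAt hZ.1.diffAt hZ.1.diffAt
  have h2 : dir η (op2 g.val Z Z) (φ p) = dir (α • S.n) S.l2 p := by
    refine (h.isLift p).dir h.embedded.contMDiff
      (g.bilinDiffAt _ _ _ hZ.1.diffAt hZ.1.diffAt) ?_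
    filter_upwards [hZ.2] with q h1
    simp only [op2, h1, h.embedded.l2_eq]
  rw [lie2, h2, dir_smul_field] at h1
  simp only [op2] at h1
  rw [bracket_swap, hZp, ← h.pScal_eq, map_neg, map_neg, neg_apply, g.symm _ (ζ p)] at h1
  linear_combination h1

/-- The pull-back of the Lie derivative of the metric along `[ζ, η]`. -/
lemma lie2_bracket (h : TangentDeformation g D S φ ζ D₀ η α) (hX : SmoothNear X p)
    (hW : SmoothNear W p) (hX' : IsLift φ p X X') (hW' : IsLift φ p W W')
    (hZ : SmoothNear Z (φ p)) (hZζ : ∀ᶠ q in 𝓝 p, Z (φ q) = ζ q) :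
    lie2 (mlieBracket (𝓡 (d + 1)) Z η) (op2 g.val) X' W' (φ p) =
      cov1 D₀ (qForm g φ ζ η) X W p + cov1 D₀ (qForm g φ ζ η) W X p
        - 2 * (dir X α p * S.s W p + dir W α p * S.s X p)
        - 2 * α p * (cov1 D₀ S.s X W p + cov1 D₀ S.s W X p)
        - 2 * cov1 D₀ (dOp α) X W p
        + 2 * S.Y p (X p) (W p) *
          (wScal g φ ζ η (fun q => push φ q (S.n q)) p - dir S.n α p)
        + S.Uf D₀ p (X p) (W p) * (pScal g φ ζ η p - α p * dir S.n S.l2 p) := by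
  set T := mlieBracket (𝓡 (d + 1)) Z η
  have hT : SmoothNear T (φ p) := hZ.bracket (h.smooth p)
  have hα := h.fdiffAt_α p
  have hZe : Extends φ ζ p Z := ⟨hZ.smoothAt, hZζ⟩
  let t : Cov1 (𝓡 d) N := fun A q => qForm g φ ζ η A q - 2 * (α q * S.s A q) - dir A α q
  have ht : ∀ {A : VF (𝓡 d) N}, SmoothNear A p →
      g.val (φ p) (T (φ p)) (push φ p (A p)) = t A p := by
    intro A hA
    rw [h.metric_bracket_push hZe hA]
    ring
  have hte : ∀ {A : VF (𝓡 d) N} {A' : VF (𝓡 (d + 1)) M}, SmoothNear A p → IsLift φ p A A' →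
      ∀ᶠ q in 𝓝 p, op2 g.val A' T (φ q) = t A q := by
    intro A A' hA hA'
    filter_upwards [hA.eventually, hA'.2, h.embedded.contMDiff.continuous.continuousAt.eventually hZ,
      eventually_eventually_nhds.2 hZζ] with q h1 h2 h3 h4
    rw [op2, g.symm, h2, h.metric_bracket_push ⟨h3, h4⟩ h1]
    ring
  have hdt : ∀ {A B : VF (𝓡 d) N}, SmoothNear B p → dir A (t B) p =
      dir A (qForm g φ ζ η B) p - 2 * (α p * dir A (S.s B) p + S.s B p * dir A α p)
        - dir A (dir B α) p := by
    intro A B hB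
    have hs := NullData.fdiffAt_s (S := S) hB
    have h1 : FDiffAt (𝓡 d) (fun q => α q * S.s B q) p := hα.mul hs
    have h2 : FDiffAt (𝓡 d) (fun q => 2 * (α q * S.s B q)) p :=
      (mdifferentiableAt_const (c := (2 : ℝ))).mul h1
    have h3 := h.fdiffAt_qForm hB
    have h4 : FDiffAt (𝓡 d) (fun q => qForm g φ ζ η B q - 2 * (α q * S.s B q)) p := h3.sub h2
    rw [dir_sub h4 (h.fdiffAt_dir_α hB), dir_sub h3 h2, dir_const_mul _ h1, dir_mul hα hs]
  have hXW := hX.cov h.metricConn.smooth hW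
  have hWX := hW.cov h.metricConn.smooth hX
  have h1 := h.leviCivita.metric_cov hX'.1.diffAt hW'.1.diffAt hT.diffAt
  rw [hX'.dir h.embedded.contMDiff (g.bilinDiffAt _ _ _ hW'.1.diffAt hT.diffAt) (hte hW hW'),
    hW'.dir h.embedded.contMDiff (g.bilinDiffAt _ _ _ hX'.1.diffAt hT.diffAt) (hte hX hX'),
    hdt hW, hdt hX, h.embedded.gauss h.leviCivita h.metricConn hX hW hX' hW', g.symm, map_sub,
    map_sub, map_smul, map_smul, push_add, map_add, ht hXW, ht hWX, ht (S.smoothNear_n p)] at h1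
  have h2 := h.metric_bracket_rigging hZe
  have h3 : qForm g φ ζ η S.n p = wScal g φ ζ η (fun q => push φ q (S.n q)) p := rfl
  have h4 : dir (cov D₀ W X) α p = dir (cov D₀ X W) α p - dir X (dir W α) p
      + dir W (dir X α) p := by
    have h5 := dir_bracket hX hW (Filter.Eventually.of_forall h.contMDiffAt_α)
    have h6 : dir (mlieBracket (𝓡 d) X W) α p
        = dir (cov D₀ X W) α p - dir (cov D₀ W X) α p := by
      simp only [dir, h.metricConn.torsionFree p X W hX.diffAt hW.diffAt, map_sub]
    linarith
  simp only [t, h3, NullData.s_n, h4, smul_eq_mul] at h1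
  simp only [cov1, dOp]
  change 2 * (g.val (φ p) (T (φ p)) (ζ p)) = _ at h2
  linear_combination h1 + S.Uf D₀ p (X p) (W p) * h2

/-- The product of `Σ` with the rigging in terms of the data and `α`. -/
lemma sigma_rigging_eq (h : TangentDeformation g D S φ ζ D₀ η α) (hX : SmoothNear X p)
    (hW : SmoothNear W p) :
    g.val (φ p) (sigma φ η D X W p) (ζ p) = nuCoeff S D₀ α X W p
      + (1 / 2) * (α p * dir S.n S.l2 p + pScal g φ ζ η p) * S.U X W p := by
  obtain ⟨X', hX'⟩ := h.embedded.exists_lift hX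
  obtain ⟨W', hW'⟩ := h.embedded.exists_lift hW
  obtain ⟨Z, hZ, hZζ⟩ := h.embedded.exists_extension p
  have hZe : Extends φ ζ p Z := ⟨hZ.smoothAt, hZζ⟩
  have hD := h.leviCivita
  have e1 := hD.lie2_lie2_eq hZ.smoothAt (h.smooth p) hX'.1 hW'.1
  have e2 := hD.lie2_lie2_eq (h.smooth p).smoothAt hZ hX'.1 hW'.1
  let y : BilinField (𝓡 d) N := fun q => (2 : ℝ) • S.Y q
  have e3 : lie2 η (op2 (deformBilin D g.val Z)) X' W' (φ p)
      = lie2 (α • S.n) (op2 y) X W p := by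
    refine (h.isLift p).lie2 h.embedded.contMDiff
      (bilinDiffAt_deformBilin hD.smooth (g.bilinDiffAt _) hZ) ?_ (h.smoothNear_smul_n p) hX hW
      hX' hW'
    filter_upwards [h.embedded.contMDiff.continuous.continuousAt.eventually hZ,
      eventually_eventually_nhds.2 hZζ] with q h1 h2 v w
    rw [h.embedded.deformBilin_push hD ⟨h1, h2⟩]
    rfl
  have hY : BilinDiffAt S.Y p := bilinDiffAt_of_contMDiff S.Y_smooth p
  have e4 : lie2 S.n (op2 y) X W p = 2 * lie2 S.n (op2 S.Y) X W p := by
    have h1 : op2 y X W = fun q => 2 * op2 S.Y X W q := rfl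
    rw [lie2, h1, dir_const_mul _ (hY _ _ hX.diffAt hW.diffAt), lie2]
    simp only [op2, y, smul_apply, smul_eq_mul]
    ring
  rw [lie2_smul_left (h.fdiffAt_α p) (S.smoothAt_n p).diffAt, e4] at e3
  have e5 := lie2_lie2_sub g.bilinSmoothAt hZ (h.smooth p) hX'.1 hW'.1
  rw [h.lie2_bracket hX hW hX' hW' hZ hZζ, e1, e2, e3, ← h.iTensor_eq hX' hW' hZe] at e5
  rw [h.sigma_rigging hX hW hZe]
  simp only [bTensor, nuCoeff, h.metricConn.U_eq hX.diffAt hW.diffAt, NullData.r, op2]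
  simp only [y, smul_apply, smul_eq_mul, S.Y_symm p (X p) (S.n p)] at e5
  linear_combination -(1 / 2) * e5

/-- The decomposition of `Σ` along the hypersurface. -/
lemma sigma_eq (h : TangentDeformation g D S φ ζ D₀ η α) (hX : SmoothNear X p)
    (hW : SmoothNear W p) (Q : Module.Dual ℝ (TangentSpace (𝓡 d) p))
    (hQ : ∀ v, Q v = g.val (φ p) (sigma φ η D X W p) (push φ p v)) :
    sigma φ η D X W p =
      ((wScal g φ ζ η (fun q => push φ q (S.n q)) p - dir S.n α p) * S.U X W p
        - α p * lie2 S.n S.U X W p) • ζ p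
      + (nuCoeff S D₀ α X W p
        + (1 / 2) * (α p * dir S.n S.l2 p + pScal g φ ζ η p) * S.U X W p) • push φ p (S.n p)
      + push φ p (S.contractP p Q) := by
  have hQn : Q (S.n p) = (wScal g φ ζ η (fun q => push φ q (S.n q)) p - dir S.n α p) * S.U X W p
        - α p * lie2 S.n S.U X W p := by
    have hr : ∀ v : TangentSpace (𝓡 d) p, S.Uf D₀ p v (S.n p) = 0 := fun v => by
      rw [NullData.Uf_symm, h.metricConn.Uf_n_left]
    have hq : qForm g φ ζ η S.n p = wScal g φ ζ η (fun q => push φ q (S.n q)) p := rfl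
    rw [hQ, h.sigma_push hX hW (S.smoothNear_n p), h.metricConn.cov2_Uf_n hX.diffAt hW.diffAt,
      hr, hr, h.metricConn.U_eq hX.diffAt hW.diffAt, h.metricConn.lie2_U hX hW, hq]
    ring
  refine h.embedded.eq_of_products (fun v => ?_) ?_
  · rw [← hQ, map_add, map_add, map_smul, map_smul, add_apply, add_apply, smul_apply, smul_apply,
      h.embedded.ℓ_eq, h.embedded.γ_eq, h.embedded.γ_eq, S.γ_n, S.γ_contractP, ← hQn]
    simp only [smul_eq_mul]
    ring
  · rw [h.sigma_rigging_eq hX hW, map_add, map_add, map_smul, map_smul, add_apply, add_apply,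
      smul_apply, smul_apply, h.embedded.l2_eq, g.symm _ (push φ p _), g.symm _ (push φ p _),
      h.embedded.ℓ_eq, h.embedded.ℓ_eq, S.ℓ_n, S.ℓ_contractP, ← hQn]
    simp only [smul_eq_mul]
    ring

/-- If `U = 0`, then `Σ` is normal along the hypersurface. -/
lemma sigma_eq_of_U_eq_zero (h : TangentDeformation g D S φ ζ D₀ η α) (hX : SmoothNear X p)
    (hW : SmoothNear W p) (hU : ∀ q X W, DiffAt X q → DiffAt W q → S.U X W q = 0) :
    sigma φ η D X W p = g.val (φ p) (sigma φ η D X W p) (ζ p) • push φ p (S.n p) := by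
  have h0 : ∀ q v w, S.Uf D₀ q v w = 0 := fun q v w => by
    have h1 := smoothNear_extend v
    have h2 := smoothNear_extend w
    have h3 := h.metricConn.U_eq h1.diffAt h2.diffAt
    rwa [hU q _ _ h1.diffAt h2.diffAt, extend_self, extend_self, eq_comm] at h3
  have hop : op2 (S.Uf D₀) = fun _ _ _ => 0 := by
    ext A B q
    exact h0 q _ _
  refine h.embedded.eq_of_products (fun v => ?_) ?_
  · have h1 := h.sigma_push hX hW (smoothNear_extend v)
    rw [extend_self] at h1
    rw [h1, hop, map_smul, smul_apply, h.embedded.γ_eq, S.γ_n]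
    simp only [cov2, dir_const, h0]
    simp
  · rw [map_smul, smul_apply, g.symm _ (push φ p _) (ζ p), h.embedded.ℓ_eq, S.ℓ_n, smul_eq_mul,
      mul_one]

end TangentDeformation

end RiggingBracket

end NullHyp

end

theorem lemma5p2 {d : ℕ}
    {N : Type*} [TopologicalSpace N] [T2Space N] [ChartedSpace (NullHyp.E d) N]
    [IsManifold (𝓡 d) ∞ N]
    {M : Type*} [TopologicalSpace M] [T2Space M] [ChartedSpace (NullHyp.E (d + 1)) M]
    [IsManifold (𝓡 (d + 1)) ∞ M]
    -- the spacetime metric and its Levi-Civita connection `∇`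
    (g : NullHyp.LorentzianMetric d M)
    (D : CovariantDerivative (𝓡 (d + 1)) (NullHyp.E (d + 1))
      (TangentSpace (𝓡 (d + 1)) : M → Type _))
    (hD : NullHyp.IsLeviCivita g D)
    -- embedded null hypersurface data and their metric hypersurface connection `∇°`
    (S : NullHyp.NullData d N) (φ : N → M) (ζ : ∀ p, TangentSpace (𝓡 (d + 1)) (φ p))
    (hS : NullHyp.IsEmbedded S g φ ζ)
    (D₀ : CovariantDerivative (𝓡 d) (NullHyp.E d) (TangentSpace (𝓡 d) : N → Type _))
    (hD₀ : S.IsMetricConn D₀)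
    -- the vector field `η` on a neighbourhood `O` of `φ(N)`, tangent and null on `φ(N)`
    (O : Set M) (hO : IsOpen O) (hφO : ∀ p, φ p ∈ O)
    (η : NullHyp.VF (𝓡 (d + 1)) M) (hη : ∀ x ∈ O, NullHyp.SmoothAt η x)
    (hη_tangent : ∀ p, ∃ v, η (φ p) = NullHyp.push φ p v)
    (hη_null : ∀ p, g.val (φ p) (η (φ p)) (η (φ p)) = 0)
    (α : N → ℝ) (hα : ∀ p, η (φ p) = α p • NullHyp.push φ p (S.n p))
    (ν : ∀ p, TangentSpace (𝓡 (d + 1)) (φ p)) (hν : NullHyp.IsNormal g φ ζ ν)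
    -- a local basis of vector fields on the open set `u`
    (u : Set N) (hu : IsOpen u) (e : Fin d → NullHyp.VF (𝓡 d) N)
    (he : IsLocalFrameOn (𝓡 d) (NullHyp.E d) ∞ e u)
    (p : N) (hp : p ∈ u) (a b : Fin d) :
    NullHyp.sigma φ η D (e a) (e b) p =
        ((NullHyp.wScal g φ ζ η ν p - NullHyp.dir S.n α p) * S.U (e a) (e b) p
            - α p * NullHyp.lie2 S.n S.U (e a) (e b) p) • ζ p
        + (NullHyp.nuCoeff S D₀ α (e a) (e b) p
            + (1 / 2) * (α p * NullHyp.dir S.n S.l2 p + NullHyp.pScal g φ ζ η p)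
              * S.U (e a) (e b) p) • ν p
        + ∑ c : Fin d, ∑ f : Fin d,
            (S.P p ((he.toBasisAt hp).coord c) ((he.toBasisAt hp).coord f)
              * ((NullHyp.dir (e a) α p * S.U (e b) (e c) p
                    + NullHyp.dir (e b) α p * S.U (e a) (e c) p)
                + S.U (e a) (e b) p * (NullHyp.qForm g φ ζ η (e c) p - NullHyp.dir (e c) α p)
                + α p * (NullHyp.cov2 D₀ S.U (e a) (e b) (e c) p
                    + NullHyp.cov2 D₀ S.U (e b) (e c) (e a) p
                    - NullHyp.cov2 D₀ S.U (e c) (e a) (e b) p)))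
              • NullHyp.push φ p (e f p)
    ∧ ((∀ q X W, NullHyp.DiffAt X q → NullHyp.DiffAt W q → S.U X W q = 0) →
        NullHyp.sigma φ η D (e a) (e b) p = NullHyp.nuCoeff S D₀ α (e a) (e b) p • ν p
        ∧ ∀ Z, NullHyp.Extends φ ζ p Z →
          NullHyp.sigma φ η D (e a) (e b) p
            = NullHyp.bTensor g φ ζ η S D₀ ν Z (e a) (e b) p • ν p) := by
  obtain rfl := hν.eq_push hS
  have h : NullHyp.TangentDeformation g D S φ ζ D₀ η α :=
    ⟨hD, hS, hD₀, fun q => Filter.eventually_of_mem (hO.mem_nhds (hφO q)) hη, hα⟩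
  have hs : ∀ i, NullHyp.SmoothNear (e i) p := fun i =>
    Filter.eventually_of_mem (hu.mem_nhds hp) fun q hq => he.contMDiffAt hu hq i
  refine ⟨?_, fun hU => ?_⟩
  · let Q : Module.Dual ℝ (TangentSpace (𝓡 d) p) :=
      (g.val (φ p) (NullHyp.sigma φ η D (e a) (e b) p)).toLinearMap ∘ₗ
        (mfderiv (𝓡 d) (𝓡 (d + 1)) φ p).toLinearMap
    rw [h.sigma_eq (hs a) (hs b) Q fun v => rfl, ← S.sum_P p (he.toBasisAt hp) Q]
    congr 1
    have hpush : ∀ v, NullHyp.push φ p v = (mfderiv (𝓡 d) (𝓡 (d + 1)) φ p).toLinearMap v :=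
      fun _ => rfl
    rw [hpush, map_sum]
    refine Finset.sum_congr rfl fun c _ => ?_
    rw [map_sum]
    refine Finset.sum_congr rfl fun f _ => ?_
    have hQ : Q (e c p) = _ := h.sigma_push (hs a) (hs b) (hs c)
    have hcyc : NullHyp.cov2 D₀ S.U (e b) (e c) (e a) p
        = NullHyp.cov2 D₀ (NullHyp.op2 (S.Uf D₀)) (e b) (e a) (e c) p := by
      rw [h.metricConn.cov2_U (hs b) (hs c) (hs a)]
      have hsymm : NullHyp.op2 (S.Uf D₀) (e c) (e a) = NullHyp.op2 (S.Uf D₀) (e a) (e c) :=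
        funext fun q => NullHyp.NullData.Uf_symm _ _
      simp only [NullHyp.cov2, hsymm]
      simp only [NullHyp.op2, NullHyp.NullData.Uf_symm (NullHyp.cov D₀ (e b) (e c) p),
        NullHyp.NullData.Uf_symm (e c p)]
      ring
    rw [map_smul, he.toBasisAt_coe, he.toBasisAt_coe, hQ, hcyc,
      h.metricConn.cov2_U (hs a) (hs b) (hs c), h.metricConn.cov2_U (hs c) (hs a) (hs b),
      h.metricConn.U_eq (hs b).diffAt (hs c).diffAt,
      h.metricConn.U_eq (hs a).diffAt (hs c).diffAt,
      h.metricConn.U_eq (hs a).diffAt (hs b).diffAt]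
    rfl
  · have h1 := h.sigma_eq_of_U_eq_zero (hs a) (hs b) hU
    refine ⟨?_, fun Z hZ => ?_⟩
    · rwa [h.sigma_rigging_eq (hs a) (hs b), hU p _ _ (hs a).diffAt (hs b).diffAt, mul_zero,
        add_zero] at h1
    · rwa [h.sigma_rigging (hs a) (hs b) hZ] at h1
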